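/- Let $n\ge 1$ and let $C,Q\in\mathbb{Q}[x_1,\dots,x_n]$ be a cubic form and a quadratic form, and let $X\subset\mathbb{P}^{n-1}$ be the variety $C=Q=0$. The order of a form $F\in\mathbb{Q}[x_1,\dots,x_n]$ is the least integer $m\ge 0$ such that for some $T\in\mathrm{GL}_n(\mathbb{Q})$ only $m$ of the variables occur in $F(T\mathbf{x})$. The $Q$-order of $C$ is the minimal order of a cubic form $C_2\in\mathbb{Q}[x_1,\dots,x_n]$ with $C-C_2=LQ$ for some linear form $L\in\mathbb{Q}[x_1,\dots,x_n]$ (possibly $L=0$). The invariant $h(F)$ is the least positive integer $h$ such that $F=A_1B_1+\dots+A_hB_h$ with forms $A_i,B_i\in\mathbb{Q}[x_1,\dots,x_n]$ of positive degree (the zero form being allowed), and $h_Q(C)$ is the minimum of $h(C+LQ)$ over all linear forms $L\in\mathbb{Q}[x_1,\dots,x_n]$ (including $L=0$). Suppose that $\operatorname{rank}(Q)\ge 5$, that the $Q$-order of $C$ is at least $4$, and that $h_Q(C)\ge 2$. Then $X$ is absolutely irreducible (that is, irreducible over $\overline{\mathbb{Q}}$), of codimension $2$ in $\mathbb{P}^{n-1}$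 and, as a reduced variety over $\overline{\mathbb{Q}}$, of degree $6$. -/

import Mathlib

open MvPolynomial

attribute [local instance] MvPolynomial.gradedAlgebra

noncomputable section

/-- The symmetric matrix of a quadratic form `Q = ∑ i j, M i j * x i * x j`. -/
def quadFormMatrix {n : ℕ} (Q : MvPolynomial (Fin n) ℚ) : Matrix (Fin n) (Fin n) ℚ :=
  Matrix.of fun i j =>
    if i = j then coeff (Finsupp.single i 2) Q
    else coeff (Finsupp.single i 1 + Finsupp.single j 1) Q / 2

/-- The rank of a quadratic form over `ℚ`. -/
def quadFormRank {n : ℕ} (Q : MvPolynomial (Fin n) ℚ) : ℕ := (quadFormMatrix Q).rank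

/-- The polynomial `F(T x)`. -/
def linearSubst {n : ℕ} (T : Matrix (Fin n) (Fin n) ℚ) (F : MvPolynomial (Fin n) ℚ) :
    MvPolynomial (Fin n) ℚ :=
  aeval (fun i => ∑ j, C (T i j) * X j) F

/-- The order of `F`: the least `m` such that, for some invertible `T`, only `m` of the variables
occur in `F(T x)`. -/
def formOrder {n : ℕ} (F : MvPolynomial (Fin n) ℚ) : ℕ :=
  sInf {m | ∃ T : GL (Fin n) ℚ,
    (linearSubst (T : Matrix (Fin n) (Fin n) ℚ) F).vars.card = m}

/-- `F₁` and `F₂` are `Q`-equivalent: `F₁ - F₂ = L * Q` for some (possibly zero) linear form `L`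
over `ℚ`. -/
def QEquivalent {n : ℕ} (Q F₁ F₂ : MvPolynomial (Fin n) ℚ) : Prop :=
  ∃ L : MvPolynomial (Fin n) ℚ, L.IsHomogeneous 1 ∧ F₁ - F₂ = L * Q

/-- The `Q`-order of a cubic form `F`: the minimal order of the cubic forms that are
`Q`-equivalent to `F`. -/
def qOrder {n : ℕ} (Q F : MvPolynomial (Fin n) ℚ) : ℕ :=
  sInf {m | ∃ F₂ : MvPolynomial (Fin n) ℚ,
    F₂.IsHomogeneous 3 ∧ QEquivalent Q F F₂ ∧ formOrder F₂ = m}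

/-- The `h`-invariant of a form `F`: the least positive `h` such that `F` is a sum of `h` products
of two forms over `ℚ`, all of positive degree. -/
def hInvariant {n : ℕ} (F : MvPolynomial (Fin n) ℚ) : ℕ :=
  sInf {h | 0 < h ∧ ∃ A B : Fin h → MvPolynomial (Fin n) ℚ,
    (∀ i, ∃ a, 0 < a ∧ (A i).IsHomogeneous a) ∧
    (∀ i, ∃ b, 0 < b ∧ (B i).IsHomogeneous b) ∧
    F = ∑ i, A i * B i}

/-- The minimal value of `h(F + L * Q)` as `L` runs over the linear forms over `ℚ`. -/
def hInvariantMod {n : ℕ} (Q F : MvPolynomial (Fin n) ℚ) : ℕ :=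
  sInf {h | ∃ L : MvPolynomial (Fin n) ℚ, L.IsHomogeneous 1 ∧ hInvariant (F + L * Q) = h}

/-- Projective space of dimension `n - 1` over `K`, that is `Proj K[x₁, …, xₙ]`, with its Zariski
topology. -/
abbrev ProjSpace (n : ℕ) (K : Type*) [Field K] : Type _ :=
  ProjectiveSpectrum (homogeneousSubmodule (Fin n) K)

/-- The locus in `(n - 1)`-dimensional projective space over the algebraic closure of `ℚ`
that is cut out by forms with rational coefficients. -/
def geometricZeroLocus {n : ℕ} (S : Set (MvPolynomial (Fin n) ℚ)) :
    Set (ProjSpace n (AlgebraicClosure ℚ)) :=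
  ProjectiveSpectrum.zeroLocus (homogeneousSubmodule (Fin n) (AlgebraicClosure ℚ))
    (MvPolynomial.map (algebraMap ℚ (AlgebraicClosure ℚ)) '' S)

/-- The codimension of a closed subset `Z` of a topological space: the infimum, over the irreducible
closed subsets `Y` of `Z`, of the supremum of the lengths of chains
`Y = Y₀ ⊂ Y₁ ⊂ ⋯ ⊂ Yᵣ` of irreducible closed subsets of the whole space. -/
def codimension {P : Type*} [TopologicalSpace P] (Z : Set P) : ℕ∞ :=
  ⨅ (Y : TopologicalSpace.IrreducibleCloseds P) (_ : (Y : Set P) ⊆ Z), Order.coheight Y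

/-- The Hilbert function of an ideal `I` of `K[x₁, …, xₙ]`: the dimension over `K` of the
degree-`m` piece of `K[x₁, …, xₙ] ⧸ I`. -/
def hilbertFunction {n : ℕ} {K : Type*} [Field K] (I : Ideal (MvPolynomial (Fin n) K)) (m : ℕ) :
    ℕ :=
  Module.finrank K ((homogeneousSubmodule (Fin n) K m).map (Ideal.Quotient.mkₐ K I).toLinearMap)

/-- The closed set `Z` in projective space (with its reduced structure) has degree `d`: the Hilbert
polynomial of the homogeneous ideal of `Z` has leading coefficient `d / r!`, where `r` is its
degree, which is the dimension of `Z`. -/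
def HasProjDegree {n : ℕ} {K : Type*} [Field K] (Z : Set (ProjSpace n K)) (d : ℕ) : Prop :=
  ∃ H : Polynomial ℚ,
    (∀ᶠ m : ℕ in Filter.atTop,
      (hilbertFunction (ProjectiveSpectrum.vanishingIdeal Z).toIdeal m : ℚ) = H.eval (m : ℚ)) ∧
    (H.natDegree.factorial : ℚ) * H.leadingCoeff = d

end

/-! Write K for the algebraic closure of ℚ, S for the polynomial ring over K, and F for the cubic.
The main point is that (F, Q) is a prime ideal of S; irreducibility, codimension and degree then
follow formally.

Since Q has rank at least 5, S/(Q) is a factorial domain (`quadric_isDomain_and_ufm`): over K one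
can write Q = uv + q with q prime, and inverting u leaves a localised polynomial ring, so Nagata's
criterion applies. Factors of a form modulo a homogeneous prime are again forms, so a cubic that is
not prime modulo Q has a linear factor L (`isPrime_span_pair_or_exists_linear_factor`).

A linear factor is excluded by taking norms (`exists_norm_factor`). Scale L so that some coefficient
is 1, and let d be the degree of the field generated by the coefficients. The d conjugates of L are
pairwise non-associate primes modulo Q that all divide F, so their product P divides F modulo Q. P
is a rational form of degree d, and it involves at most d variables after a rational change of
coordinates. Now `not_linear_factor` compares degrees: d < 3 gives h_Q ≤ 1, d = 3 gives Q-order at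
most 3, and d > 3 forces Q ∣ F, hence Q-order 0.

Once I = (F, Q) is prime, it is the generic point of its zero locus and the full vanishing ideal of
that locus. Krull's height theorem and the chain V(F, Q) ⊂ V(Q) ⊂ ℙ give codimension 2. As F and Q
have no common factor, the Hilbert series of S/I is (1 - t²)(1 - t³)/(1 - t)ⁿ = (1 + 2t + 2t² +
t³)/(1 - t)ⁿ⁻², and 1 + 2 + 2 + 1 = 6 is the degree. -/

noncomputable section

/-! ### Factors of forms modulo a homogeneous prime; diagonal quadratic forms -/

section HomogeneousFactors

variable {σ K : Type*} [Field K]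

/-- The homomorphism `x ↦ ∑ i, xᵢ tⁱ` where `xᵢ` is the class of the degree-`i` part of `x`. -/
def gradingHom (P : Ideal (MvPolynomial σ K)) :
    MvPolynomial σ K →ₐ[K] Polynomial (MvPolynomial σ K ⧸ P) :=
  aeval fun i => Polynomial.C (Ideal.Quotient.mk P (X i)) * Polynomial.X

theorem prod_mul_pow_eq {ι R : Type*} [CommSemiring R] (s : Finset ι) (f : ι → R) (t : R)
    (m : ι → ℕ) : ∏ i ∈ s, (f i * t) ^ m i = (∏ i ∈ s, f i ^ m i) * t ^ ∑ i ∈ s, m i := by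
  simp only [mul_pow, Finset.prod_mul_distrib, Finset.prod_pow_eq_pow_sum]

theorem gradingHom_of_isHomogeneous (P : Ideal (MvPolynomial σ K)) {F : MvPolynomial σ K} {d : ℕ}
    (hF : F.IsHomogeneous d) :
    gradingHom P F = Polynomial.C (Ideal.Quotient.mk P F) * Polynomial.X ^ d := by
  conv_lhs => rw [F.as_sum]
  conv_rhs => rw [F.as_sum]
  simp only [map_sum, Finset.sum_mul]
  refine Finset.sum_congr rfl fun m hm => ?_
  have hdeg : m.degree = d := (hF.degree_eq_sum_deg_support hm).symm
  rw [gradingHom, aeval_monomial, monomial_eq, map_mul, map_mul, mul_assoc]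
  congr 1
  simp only [Finsupp.prod, map_prod, map_pow, ← hdeg, Finsupp.degree_apply]
  exact prod_mul_pow_eq _ _ _ _

theorem coeff_gradingHom (P : Ideal (MvPolynomial σ K)) (F : MvPolynomial σ K) (i : ℕ) :
    (gradingHom P F).coeff i = Ideal.Quotient.mk P (homogeneousComponent i F) := by
  conv_lhs => rw [← sum_homogeneousComponent F]
  rw [map_sum, Polynomial.finsetSum_coeff]
  simp only [gradingHom_of_isHomogeneous P (homogeneousComponent_isHomogeneous _ F),
    Polynomial.coeff_C_mul_X_pow]
  rw [Finset.sum_ite_eq]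
  split_ifs with h
  · rfl
  · rw [homogeneousComponent_eq_zero _ _ (by simpa using h), map_zero]

theorem homogeneousComponent_mem {P : Ideal (MvPolynomial σ K)}
    (hP : P.IsHomogeneous (homogeneousSubmodule σ K)) {F : MvPolynomial σ K} (hF : F ∈ P) (i : ℕ) :
    homogeneousComponent i F ∈ P := by
  have := hP i hF
  rwa [← decomposition.decompose'_apply]

theorem gradingHom_eq_zero {P : Ideal (MvPolynomial σ K)}
    (hP : P.IsHomogeneous (homogeneousSubmodule σ K)) {F : MvPolynomial σ K} (hF : F ∈ P) :
    gradingHom P F = 0 := by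
  ext i
  rw [coeff_gradingHom, Polynomial.coeff_zero, Ideal.Quotient.eq_zero_iff_mem]
  exact homogeneousComponent_mem hP hF i

theorem sub_homogeneousComponent_mem {P : Ideal (MvPolynomial σ K)} {F : MvPolynomial σ K}
    {a : ℕ} (h : ∀ i ≠ a, (gradingHom P F).coeff i = 0) : F - homogeneousComponent a F ∈ P := by
  rw [← Ideal.Quotient.eq_zero_iff_mem, map_sub, sub_eq_zero]
  conv_lhs => rw [← sum_homogeneousComponent F]
  rw [map_sum, Finset.sum_eq_single a]
  · exact fun i _ hi => by rw [← coeff_gradingHom, h i hi]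
  · intro h
    rw [homogeneousComponent_eq_zero _ _ (by simpa using h), map_zero]

theorem coeff_eq_zero_of_natTrailingDegree_eq {R : Type*} [Semiring R] {p : Polynomial R}
    (h : p.natDegree ≤ p.natTrailingDegree) (i : ℕ) (hi : i ≠ p.natDegree) : p.coeff i = 0 := by
  rcases lt_or_gt_of_ne hi with h1 | h1
  · exact Polynomial.coeff_eq_zero_of_lt_natTrailingDegree (h1.trans_le h)
  · exact Polynomial.coeff_eq_zero_of_natDegree_lt h1

/-- Modulo a homogeneous prime ideal, the factors of a nonzero form are forms. -/
theorem exists_homogeneous_factors {P : Ideal (MvPolynomial σ K)} [P.IsPrime]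
    (hP : P.IsHomogeneous (homogeneousSubmodule σ K)) {A B F : MvPolynomial σ K} {d : ℕ}
    (hF : F.IsHomogeneous d) (hFP : F ∉ P) (hAB : A * B - F ∈ P) :
    ∃ a b, a + b = d ∧ A - homogeneousComponent a A ∈ P ∧ B - homogeneousComponent b B ∈ P := by
  have h : gradingHom P A * gradingHom P B =
      Polynomial.C (Ideal.Quotient.mk P F) * Polynomial.X ^ d := by
    rw [← gradingHom_of_isHomogeneous P hF, ← map_mul, ← sub_eq_zero, ← map_sub]
    exact gradingHom_eq_zero hP hAB
  have hc : Ideal.Quotient.mk P F ≠ 0 := by rwa [Ne, Ideal.Quotient.eq_zero_iff_mem]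
  have h0 : gradingHom P A * gradingHom P B ≠ 0 := by
    rw [h]; simpa using hc
  have hA0 := left_ne_zero_of_mul h0
  have hB0 := right_ne_zero_of_mul h0
  -- The product is a monomial in t over a domain. Degree and trailing degree are both additive
  -- there, so they must agree on each factor, which is therefore a monomial too.
  have h1 := congrArg Polynomial.natDegree h
  have h2 := congrArg Polynomial.natTrailingDegree h
  rw [Polynomial.natDegree_mul hA0 hB0, Polynomial.natDegree_C_mul_X_pow _ _ hc] at h1
  rw [Polynomial.natTrailingDegree_mul hA0 hB0, Polynomial.C_mul_X_pow_eq_monomial,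
    Polynomial.natTrailingDegree_monomial hc] at h2
  have h3 := Polynomial.natTrailingDegree_le_natDegree (gradingHom P A)
  have h4 := Polynomial.natTrailingDegree_le_natDegree (gradingHom P B)
  exact ⟨_, _, h1,
    sub_homogeneousComponent_mem (coeff_eq_zero_of_natTrailingDegree_eq (by omega)),
    sub_homogeneousComponent_mem (coeff_eq_zero_of_natTrailingDegree_eq (by omega))⟩

theorem isHomogeneous_span_singleton {F : MvPolynomial σ K} {d : ℕ} (hF : F.IsHomogeneous d) :
    (Ideal.span {F}).IsHomogeneous (homogeneousSubmodule σ K) :=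
  Ideal.homogeneous_span _ _ fun x hx => ⟨d, by rw [Set.mem_singleton_iff.1 hx]; exact hF⟩

/-- The linear form with given coefficients. -/
def linearForm {R ι : Type*} [CommSemiring R] [Fintype ι] (c : ι → R) : MvPolynomial ι R :=
  ∑ i, C (c i) * X i

theorem linearForm_isHomogeneous {R ι : Type*} [CommSemiring R] [Fintype ι] (c : ι → R) :
    (linearForm c).IsHomogeneous 1 :=
  IsHomogeneous.sum _ _ _ fun i _ => by
    simpa using (isHomogeneous_C ι (c i)).mul (isHomogeneous_X R i)

theorem coeff_linearForm {R ι : Type*} [CommSemiring R] [Fintype ι] (c : ι → R) (i : ι) :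
    coeff (Finsupp.single i 1) (linearForm c) = c i := by
  classical
  simp [linearForm, coeff_sum, coeff_C_mul, coeff_X, Finsupp.single_left_inj]

theorem linearForm_map {R S ι : Type*} [CommSemiring R] [CommSemiring S] [Fintype ι]
    (f : R →+* S) (c : ι → R) :
    map f (linearForm c) = linearForm fun i => f (c i) := by
  simp [linearForm]

theorem MvPolynomial.IsHomogeneous.eq_linearForm {R ι : Type*} [CommSemiring R] [Fintype ι]
    {L : MvPolynomial ι R} (hL : L.IsHomogeneous 1) :
    L = linearForm fun i => coeff (Finsupp.single i 1) L := by
  ext m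
  by_cases hm : m.degree = 1
  · obtain ⟨i, rfl⟩ : ∃ i, m = Finsupp.single i 1 := by
      obtain ⟨i, hi⟩ := (Finsupp.sum_eq_one_iff m).1 hm
      exact ⟨i, hi⟩
    rw [coeff_linearForm]
  · rw [hL.coeff_eq_zero hm, (linearForm_isHomogeneous _).coeff_eq_zero hm]

theorem isUnit_of_isHomogeneous_zero {F : MvPolynomial σ K} (hF : F.IsHomogeneous 0)
    (h0 : F ≠ 0) : IsUnit F := by
  rw [← totalDegree_zero_iff_isHomogeneous, totalDegree_eq_zero_iff_eq_C] at hF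
  rw [hF] at h0 ⊢
  exact (IsUnit.mk0 _ fun h => h0 (by rw [h, C_0])).map C

/-- A diagonal quadratic form with at least three nonzero coefficients is prime. -/
theorem prime_sum_mul_X_sq {ι : Type*} [Fintype ι] (w : ι → K) (h2 : (2 : K) ≠ 0) {i j k : ι}
    (hij : i ≠ j) (hik : i ≠ k) (hjk : j ≠ k) (hi : w i ≠ 0) (hj : w j ≠ 0) (hk : w k ≠ 0) :
    Prime (∑ l, C (w l) * X l ^ 2 : MvPolynomial ι K) := by
  classical
  set q : MvPolynomial ι K := ∑ l, C (w l) * X l ^ 2 with hq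
  have hqh : q.IsHomogeneous 2 := IsHomogeneous.sum _ _ _ fun l _ => by
    simpa using (isHomogeneous_C ι (w l)).mul ((isHomogeneous_X K l).pow 2)
  have hev : ∀ v : ι → K, eval v q = ∑ l, w l * v l ^ 2 := fun v => by simp [hq]
  have hq0 : q ≠ 0 := fun h => hi (by simpa [h, Pi.single_apply] using (hev (Pi.single i 1)).symm)
  rw [← irreducible_iff_prime, irreducible_iff]
  constructor
  · intro hu
    rw [isUnit_iff_totalDegree_of_isReduced, hqh.totalDegree hq0] at hu
    exact two_ne_zero hu.2
  · intro A B hAB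
    obtain ⟨a, b, hab, ha, hb⟩ := exists_homogeneous_factors (P := ⊥)
      (Ideal.IsHomogeneous.bot _) hqh (by simpa using hq0) (show A * B - q ∈ ⊥ by simp [hAB])
    rw [Ideal.mem_bot, sub_eq_zero] at ha hb
    have hA : A.IsHomogeneous a := ha ▸ homogeneousComponent_isHomogeneous _ _
    have hB : B.IsHomogeneous b := hb ▸ homogeneousComponent_isHomogeneous _ _
    have hA0 : A ≠ 0 := fun h => hq0 (by rw [hAB, h, zero_mul])
    have hB0 : B ≠ 0 := fun h => hq0 (by rw [hAB, h, mul_zero])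
    obtain rfl | rfl | rfl : a = 0 ∨ b = 0 ∨ a = 1 := by omega
    · exact Or.inl (isUnit_of_isHomogeneous_zero hA hA0)
    · exact Or.inr (isUnit_of_isHomogeneous_zero hB hB0)
    · exfalso
      obtain rfl : b = 1 := by omega
      obtain ⟨α, hα⟩ : ∃ α, A = linearForm α := ⟨_, hA.eq_linearForm⟩
      obtain ⟨β, hβ⟩ : ∃ β, B = linearForm β := ⟨_, hB.eq_linearForm⟩
      have hs : ∀ l, w l = α l * β l := fun l => by
        have := congrArg (eval (Pi.single l 1)) hAB
        rw [hev, map_mul, hα, hβ] at this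
        simpa [linearForm, Pi.single_apply] using this
      have hd : ∀ l m, l ≠ m → α l * β m + α m * β l = 0 := fun l m hlm => by
        have := congrArg (eval (Pi.single l 1 + Pi.single m 1)) hAB
        rw [hev, map_mul, hα, hβ] at this
        simp only [linearForm, map_sum, map_mul, eval_C, eval_X, Pi.add_apply, Pi.single_apply,
          mul_add, mul_ite, mul_one, mul_zero, Finset.sum_add_distrib, Finset.sum_ite_eq',
          Finset.mem_univ, if_true] at this
        have h3 : ∀ x, w x * ((if x = l then (1 : K) else 0) + if x = m then 1 else 0) ^ 2 =
            (if x = l then w l else 0) + (if x = m then w m else 0) := fun x => by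
          by_cases h1 : x = l
          · subst h1; simp [hlm]
          · by_cases h2 : x = m
            · subst h2; simp [h1]
            · simp [h1, h2]
        simp only [h3, Finset.sum_add_distrib, Finset.sum_ite_eq', Finset.mem_univ, if_true,
          hs l, hs m] at this
        linear_combination -this
      have e1 := hd i j hij
      have e2 := hd i k hik
      have e3 := hd j k hjk
      rw [hs] at hi hj hk
      -- Swapping indices in α i β j, α j β k and α k β i changes the sign three times but permutes
      -- the factors of the product, so that product equals its own negative.
      have : 2 * (α i * β i) * (α j * β j) * (α k * β k) = 0 := by
        linear_combination (α j * β k * α k * β i) * e1 + (α j * β i * α k * β j) * e2 -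
          (α j * β i * α k * β i) * e3
      exact mul_ne_zero (mul_ne_zero (mul_ne_zero h2 hi) hj) hk this

end HomogeneousFactors

/-! ### Nagata's criterion and the ring A[u, v]/(uv + q) -/

/-- **Nagata's criterion**, for a homomorphism that inverts a prime element. -/
theorem UniqueFactorizationMonoid.of_injective_of_prime {R B : Type*} [CommRing R] [IsDomain R]
    [IsNoetherianRing R] [CommRing B] [UniqueFactorizationMonoid B] (f : R →+* B)
    (hf : Function.Injective f) {x : R} (hx : Prime x) (hu : IsUnit (f x))
    (hs : ∀ z, ∃ (k : ℕ) (r : R), z * f x ^ k = f r) : UniqueFactorizationMonoid R := by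
  let := f.toAlgebra
  have : IsLocalization.Away x B := by
    refine ⟨?_, ?_, ?_⟩
    · rintro ⟨_, k, rfl⟩
      change IsUnit (f (x ^ k))
      rw [map_pow]
      exact hu.pow k
    · intro z
      obtain ⟨k, r, h⟩ := hs z
      refine ⟨⟨r, ⟨_, k, rfl⟩⟩, ?_⟩
      change z * f (x ^ k) = f r
      rw [map_pow, h]
    · intro x y hxy
      exact ⟨1, by rw [hf hxy]⟩
  exact (iff_of_isLocalizationAway_of_prime hx B).2 ‹_›

/-- The form in which Nagata's criterion is applied: the localisation of the quotient is presented
by a map `g` on `D` itself, with kernel generated by `p`. -/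
theorem UniqueFactorizationMonoid.quotient_of_prime {D B : Type*} [CommRing D] [IsNoetherianRing D]
    [CommRing B] [UniqueFactorizationMonoid B] (g : D →+* B) {p : D}
    [IsDomain (D ⧸ Ideal.span {p})] (hg : ∀ x, g x = 0 ↔ p ∣ x) {u : D}
    (hu : Prime (Ideal.Quotient.mk (Ideal.span {p}) u)) (hgu : IsUnit (g u))
    (hs : ∀ z, ∃ (k : ℕ) (r : D), z * g u ^ k = g r) :
    UniqueFactorizationMonoid (D ⧸ Ideal.span {p}) := by
  refine of_injective_of_prime (Ideal.Quotient.lift (Ideal.span {p}) g fun a ha =>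
    (hg a).2 (Ideal.mem_span_singleton.1 ha)) ?_ hu (by simpa using hgu) fun z => ?_
  · rw [injective_iff_map_eq_zero]
    intro a ha
    obtain ⟨a, rfl⟩ := Ideal.Quotient.mk_surjective a
    rw [Ideal.Quotient.lift_mk, hg] at ha
    exact Ideal.Quotient.eq_zero_iff_mem.2 (Ideal.mem_span_singleton.2 ha)
  · obtain ⟨k, r, h⟩ := hs z
    exact ⟨k, Ideal.Quotient.mk _ r, by simpa using h⟩

section HyperbolicQuotient

open Polynomial LaurentPolynomial

variable {A : Type*} [CommRing A]

/-- The polynomial `u * v + q` in the two variables `u`, `v`. -/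
def hyperbolicPoly (q : A) : A[X][X] := Polynomial.C Polynomial.X * Polynomial.X + Polynomial.C (Polynomial.C q)

theorem hyperbolicPoly_natDegree [Nontrivial A] (q : A) : (hyperbolicPoly q).natDegree = 1 :=
  Polynomial.natDegree_linear Polynomial.X_ne_zero

/-- It is linear in v, and its coefficients u and q are coprime in A[u] because u is prime and does
not divide a nonzero constant. -/
theorem hyperbolicPoly_prime [IsDomain A] [UniqueFactorizationMonoid A] {q : A} (hq : q ≠ 0) :
    Prime (hyperbolicPoly q) := by
  rw [← irreducible_iff_prime]
  exact irreducible_C_mul_X_add_C Polynomial.X_ne_zero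
    ((prime_X.irreducible.isRelPrime_iff_not_dvd).2 fun h => hq (by simpa using Polynomial.X_dvd_iff.1 h))

/-- The substitution `v ↦ - q / u`. -/
def hyperbolicEval (q : A) : A[X][X] →+* A[T;T⁻¹] :=
  eval₂RingHom (algebraMap A[X] A[T;T⁻¹]) (-(algebraMap A[X] A[T;T⁻¹] (Polynomial.C q) * T (-1)))

theorem hyperbolicEval_C (q : A) (a : A[X]) :
    hyperbolicEval q (Polynomial.C a) = algebraMap A[X] A[T;T⁻¹] a := by
  simp [hyperbolicEval]

theorem hyperbolicEval_hyperbolicPoly (q : A) : hyperbolicEval q (hyperbolicPoly q) = 0 := by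
  have : (algebraMap A[X] A[T;T⁻¹]) Polynomial.X = T 1 := by simp
  rw [hyperbolicPoly, map_add, map_mul, hyperbolicEval_C, hyperbolicEval_C, this]
  simp only [hyperbolicEval, coe_eval₂RingHom, Polynomial.eval₂_X]
  have h : (T 1 * T (-1) : A[T;T⁻¹]) = 1 := by rw [← T_add]; simp
  linear_combination -(algebraMap A[X] A[T;T⁻¹] (Polynomial.C q)) * h

/-- Since uv ≡ -q, a high enough power of u eliminates v. -/
theorem exists_dvd_pow_mul_sub_C (q : A) (g : A[X][X]) :
    ∃ (k : ℕ) (a : A[X]), hyperbolicPoly q ∣ Polynomial.C Polynomial.X ^ k * g - Polynomial.C a := by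
  induction g using Polynomial.induction_on' with
  | add g h hg hh =>
    obtain ⟨k, a, x, hx⟩ := hg
    obtain ⟨l, b, y, hy⟩ := hh
    refine ⟨k + l, Polynomial.X ^ l * a + Polynomial.X ^ k * b,
      Polynomial.C Polynomial.X ^ l * x + Polynomial.C Polynomial.X ^ k * y, ?_⟩
    simp only [map_add, map_mul, map_pow, pow_add]
    linear_combination (Polynomial.C Polynomial.X ^ l) * hx + (Polynomial.C Polynomial.X ^ k) * hy
  | monomial n a =>
    refine ⟨n, a * (-Polynomial.C q) ^ n, ?_⟩
    have h := sub_dvd_pow_sub_pow (Polynomial.C Polynomial.X * Polynomial.X : A[X][X])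
      (Polynomial.C (-Polynomial.C q)) n
    have h1 : (Polynomial.C Polynomial.X * Polynomial.X : A[X][X]) - Polynomial.C (-Polynomial.C q) = hyperbolicPoly q := by
      rw [map_neg, sub_neg_eq_add, hyperbolicPoly]
    rw [h1] at h
    refine (h.mul_left (Polynomial.C a)).trans (dvd_of_eq ?_)
    rw [← Polynomial.C_mul_X_pow_eq_monomial, map_mul, map_pow]
    ring

/-- After v is eliminated from u^k g, the remaining polynomial in u vanishes because A[u] embeds in
the Laurent polynomials. Hence the prime uv + q divides u^k g, and it cannot divide u^k because of
its degree in v. -/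
theorem hyperbolicEval_eq_zero_iff [IsDomain A] [UniqueFactorizationMonoid A] {q : A}
    (hq : q ≠ 0) (g : A[X][X]) : hyperbolicEval q g = 0 ↔ hyperbolicPoly q ∣ g := by
  refine ⟨fun h => ?_, fun ⟨x, hx⟩ => by rw [hx, map_mul, hyperbolicEval_hyperbolicPoly, zero_mul]⟩
  obtain ⟨k, a, x, hx⟩ := exists_dvd_pow_mul_sub_C q g
  have h1 := congrArg (hyperbolicEval q) hx
  rw [map_sub, map_mul, map_mul, h, hyperbolicEval_hyperbolicPoly, hyperbolicEval_C, mul_zero,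
    zero_mul, zero_sub, neg_eq_zero, algebraMap_eq_toLaurent, toLaurent_eq_zero] at h1
  rw [h1, map_zero, sub_zero] at hx
  have hp := hyperbolicPoly_prime hq
  refine (hp.dvd_or_dvd ⟨x, hx⟩).resolve_left fun hd => ?_
  have := Polynomial.natDegree_le_of_dvd (hp.dvd_of_dvd_pow hd) (by simp)
  rw [hyperbolicPoly_natDegree] at this
  simp at this

/-- The substitution `u ↦ 0`, with coefficients modulo `q`. -/
def hyperbolicReduce (q : A) : A[X][X] →+* (A ⧸ Ideal.span {q})[X] :=
  mapRingHom ((Ideal.Quotient.mk (Ideal.span {q})).comp (evalRingHom 0))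

theorem hyperbolicReduce_eq_zero_iff (q : A) (g : A[X][X]) :
    hyperbolicReduce q g = 0 ↔ ∃ a b, g = Polynomial.C Polynomial.X * a + hyperbolicPoly q * b := by
  constructor
  · intro h
    have h1 : ∀ n, ∃ c d : A[X], g.coeff n = Polynomial.X * c + Polynomial.C q * d := fun n => by
      have h2 := congrArg (fun p => p.coeff n) h
      simp only [hyperbolicReduce, coe_mapRingHom, Polynomial.coeff_map, RingHom.comp_apply, Polynomial.coeff_zero,
        coe_evalRingHom, Ideal.Quotient.eq_zero_iff_mem, Ideal.mem_span_singleton] at h2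
      obtain ⟨d, hd⟩ := h2
      obtain ⟨c, hc⟩ := X_dvd_sub_C (p := g.coeff n)
      rw [Polynomial.coeff_zero_eq_eval_zero, hd] at hc
      exact ⟨c, Polynomial.C d, by rw [← hc, map_mul]; ring⟩
    choose c d hcd using h1
    rw [g.as_sum_range_C_mul_X_pow]
    have h3 : ∀ n, ∃ a b, Polynomial.C (g.coeff n) * Polynomial.X ^ n =
        Polynomial.C Polynomial.X * a + hyperbolicPoly q * b := fun n => by
      -- Multiples of q are rewritten through q = (uv + q) - uv.
      refine ⟨Polynomial.C (c n) * Polynomial.X ^ n - Polynomial.X * Polynomial.C (d n) * Polynomial.X ^ n,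
        Polynomial.C (d n) * Polynomial.X ^ n, ?_⟩
      rw [hcd, hyperbolicPoly, map_add, map_mul, map_mul]
      ring
    choose a b hab using h3
    refine ⟨∑ n ∈ Finset.range (g.natDegree + 1), a n,
      ∑ n ∈ Finset.range (g.natDegree + 1), b n, ?_⟩
    rw [Finset.mul_sum, Finset.mul_sum, ← Finset.sum_add_distrib]
    exact Finset.sum_congr rfl fun n _ => hab n
  · rintro ⟨a, b, rfl⟩
    have : Ideal.Quotient.mk (Ideal.span {q}) q = 0 :=
      Ideal.Quotient.eq_zero_iff_mem.2 (Ideal.mem_span_singleton_self q)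
    simp [hyperbolicReduce, hyperbolicPoly, this]

theorem hyperbolicQuotient_isDomain [IsDomain A] [UniqueFactorizationMonoid A] {q : A}
    (hq : q ≠ 0) : IsDomain (A[X][X] ⧸ Ideal.span {hyperbolicPoly q}) := by
  have := (Ideal.span_singleton_prime (hyperbolicPoly_prime hq).ne_zero).2 (hyperbolicPoly_prime hq)
  infer_instance

theorem hyperbolicQuotient_mk_u_dvd (q : A) (g : A[X][X]) :
    Ideal.Quotient.mk (Ideal.span {hyperbolicPoly q}) (Polynomial.C Polynomial.X) ∣
      Ideal.Quotient.mk (Ideal.span {hyperbolicPoly q}) g ↔ hyperbolicReduce q g = 0 := by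
  rw [hyperbolicReduce_eq_zero_iff]
  constructor
  · rintro ⟨x, hx⟩
    obtain ⟨x, rfl⟩ := Ideal.Quotient.mk_surjective x
    rw [← map_mul, Ideal.Quotient.eq, Ideal.mem_span_singleton] at hx
    obtain ⟨b, hb⟩ := hx
    exact ⟨x, b, by rw [← hb]; ring⟩
  · rintro ⟨a, b, rfl⟩
    refine ⟨Ideal.Quotient.mk _ a, ?_⟩
    rw [← map_mul, Ideal.Quotient.eq, Ideal.mem_span_singleton]
    exact ⟨b, by ring⟩

/-- Killing u leaves (A/q)[v], which is a domain. -/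
theorem hyperbolicQuotient_prime_u [IsDomain A] [UniqueFactorizationMonoid A] {q : A}
    (hq : Prime q) :
    Prime (Ideal.Quotient.mk (Ideal.span {hyperbolicPoly q}) (Polynomial.C Polynomial.X)) := by
  have := (Ideal.span_singleton_prime hq.ne_zero).2 hq
  refine ⟨?_, ?_, ?_⟩
  · rw [Ne, Ideal.Quotient.eq_zero_iff_mem, Ideal.mem_span_singleton]
    intro h
    have := Polynomial.natDegree_le_of_dvd h (by simp)
    rw [hyperbolicPoly_natDegree] at this
    simp at this
  · rw [isUnit_iff_dvd_one, ← map_one (Ideal.Quotient.mk _), hyperbolicQuotient_mk_u_dvd, map_one]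
    exact one_ne_zero
  · intro a b
    obtain ⟨a, rfl⟩ := Ideal.Quotient.mk_surjective a
    obtain ⟨b, rfl⟩ := Ideal.Quotient.mk_surjective b
    rw [← map_mul, hyperbolicQuotient_mk_u_dvd, hyperbolicQuotient_mk_u_dvd,
      hyperbolicQuotient_mk_u_dvd, map_mul, mul_eq_zero]
    exact id

/-- Inverting the prime u allows v to be solved for, which gives A[u, u⁻¹]. This ring is factorial
as a localisation of A[u], so Nagata's criterion applies. -/
theorem hyperbolicQuotient_ufm [IsDomain A] [IsNoetherianRing A] [UniqueFactorizationMonoid A]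
    {q : A} (hq : Prime q) :
    UniqueFactorizationMonoid (A[X][X] ⧸ Ideal.span {hyperbolicPoly q}) := by
  have := hyperbolicQuotient_isDomain hq.ne_zero
  have hT : hyperbolicEval q (Polynomial.C Polynomial.X) = T 1 := by
    rw [hyperbolicEval_C]; simp
  have : UniqueFactorizationMonoid A[T;T⁻¹] :=
    UniqueFactorizationMonoid.of_isLocalization (Submonoid.powers (Polynomial.X : A[X])) _
  refine UniqueFactorizationMonoid.quotient_of_prime (hyperbolicEval q)
    (hyperbolicEval_eq_zero_iff hq.ne_zero) (hyperbolicQuotient_prime_u hq)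
    (by rw [hT]; exact isUnit_T 1) fun z => ?_
  obtain ⟨⟨x, ⟨_, k, rfl⟩⟩, hx⟩ := IsLocalization.surj (Submonoid.powers (Polynomial.X : A[X])) z
  refine ⟨k, Polynomial.C x, ?_⟩
  rw [hT, hyperbolicEval_C, ← hx]
  simp

end HyperbolicQuotient

/-! ### Linear substitutions and diagonalisation of quadratic forms -/

section LinearSubstitution

variable {ι K : Type*} [Fintype ι] [CommRing K]

/-- The substitution `x ↦ T x` as an algebra homomorphism. -/
def linearSubstHom (T : Matrix ι ι K) : MvPolynomial ι K →ₐ[K] MvPolynomial ι K :=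
  aeval fun i => ∑ j, C (T i j) * X j

theorem linearSubstHom_comp (S T : Matrix ι ι K) :
    (linearSubstHom T).comp (linearSubstHom S) = linearSubstHom (S * T) := by
  ext1 i
  simp only [linearSubstHom, AlgHom.comp_apply, aeval_X, map_sum, map_mul, algHom_C, Finset.mul_sum,
    Matrix.mul_apply, algebraMap_eq, Finset.sum_mul]
  rw [Finset.sum_comm]
  simp only [mul_assoc]

theorem linearSubstHom_one [DecidableEq ι] :
    linearSubstHom (1 : Matrix ι ι K) = AlgHom.id K _ := by
  ext1 i
  simp [linearSubstHom, Matrix.one_apply]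

/-- The substitution `x ↦ T x` for invertible `T`. -/
def linearSubstEquiv [DecidableEq ι] (T : GL ι K) : MvPolynomial ι K ≃ₐ[K] MvPolynomial ι K :=
  AlgEquiv.ofAlgHom (linearSubstHom T) (linearSubstHom (T⁻¹ : GL ι K))
    (by rw [linearSubstHom_comp, ← Units.val_mul, inv_mul_cancel, Units.val_one,
      linearSubstHom_one])
    (by rw [linearSubstHom_comp, ← Units.val_mul, mul_inv_cancel, Units.val_one,
      linearSubstHom_one])

/-- The quadratic form of a matrix. -/
def matrixForm (M : Matrix ι ι K) : MvPolynomial ι K := ∑ i, ∑ j, C (M i j) * X i * X j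

open Matrix in
theorem matrixForm_eq_dotProduct (M : Matrix ι ι K) :
    matrixForm M = X ⬝ᵥ (M.map C *ᵥ (X : ι → MvPolynomial ι K)) := by
  simp only [matrixForm, dotProduct, mulVec, Finset.mul_sum, map_apply]
  exact Finset.sum_congr rfl fun i _ => Finset.sum_congr rfl fun j _ => by ring

open Matrix in
theorem linearSubstHom_matrixForm (T M : Matrix ι ι K) :
    linearSubstHom T (matrixForm M) = matrixForm (T.transpose * M * T) := by
  have hX : ∀ i, linearSubstHom T (X i) = (T.map C *ᵥ (X : ι → MvPolynomial ι K)) i := fun i => by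
    simp [linearSubstHom, mulVec, dotProduct]
  have h : linearSubstHom T (matrixForm M) =
      (T.map C *ᵥ (X : ι → MvPolynomial ι K)) ⬝ᵥ (M.map C *ᵥ (T.map C *ᵥ X)) := by
    simp only [matrixForm, map_sum, map_mul, hX, algHom_C, algebraMap_eq]
    generalize T.map C *ᵥ (X : ι → MvPolynomial ι K) = Y
    simp only [dotProduct, Finset.mul_sum, mulVec, map_apply]
    exact Finset.sum_congr rfl fun i _ => Finset.sum_congr rfl fun j _ => by ring
  rw [h, matrixForm_eq_dotProduct, Matrix.map_mul, Matrix.map_mul, ← mulVec_mulVec,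
    ← mulVec_mulVec, dotProduct_mulVec X, transpose_map, vecMul_transpose]

theorem matrixForm_diagonal [DecidableEq ι] (w : ι → K) :
    matrixForm (Matrix.diagonal w) = ∑ k, C (w k) * X k ^ 2 := by
  refine Finset.sum_congr rfl fun i _ => ?_
  rw [Finset.sum_eq_single i]
  · rw [Matrix.diagonal_apply_eq, mul_assoc, sq]
  · intro j _ hj
    rw [Matrix.diagonal_apply_ne _ hj.symm]; simp
  · simp

theorem matrixForm_isHomogeneous (M : Matrix ι ι K) : (matrixForm M).IsHomogeneous 2 :=
  IsHomogeneous.sum _ _ _ fun i _ => IsHomogeneous.sum _ _ _ fun j _ => by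
    simpa using ((isHomogeneous_C ι (M i j)).mul (isHomogeneous_X K i)).mul (isHomogeneous_X K j)

end LinearSubstitution

theorem exists_eq_single_add_single {ι : Type*} {m : ι →₀ ℕ} (h : m.degree = 2) :
    ∃ a b, m = Finsupp.single a 1 + Finsupp.single b 1 := by
  classical
  have hc : (Finsupp.toMultiset m).card = 2 := by
    rw [Finsupp.card_toMultiset, ← h]; rfl
  obtain ⟨a, b, hab⟩ := Multiset.card_eq_two.1 hc
  refine ⟨a, b, Multiset.toFinsupp.symm.injective ?_⟩
  rw [Multiset.toFinsupp_symm_apply, Multiset.toFinsupp_symm_apply, hab, map_add,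
    Finsupp.toMultiset_single, Finsupp.toMultiset_single, one_nsmul, one_nsmul]
  rfl

theorem eq_matrixForm {n : ℕ} {Q : MvPolynomial (Fin n) ℚ} (hQ : Q.IsHomogeneous 2) :
    Q = matrixForm (quadFormMatrix Q) := by
  ext m
  by_cases hm : m.degree = 2
  · obtain ⟨a, b, rfl⟩ := exists_eq_single_add_single hm
    have h1 : ∀ i j, coeff (Finsupp.single a 1 + Finsupp.single b 1)
        (C (quadFormMatrix Q i j) * X i * X j) =
        if (i = a ∧ j = b) ∨ (i = b ∧ j = a) then quadFormMatrix Q i j else 0 := fun i j => by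
      have : (C (quadFormMatrix Q i j) * X i * X j : MvPolynomial (Fin n) ℚ) =
          monomial (Finsupp.single i 1 + Finsupp.single j 1) (quadFormMatrix Q i j) := by
        rw [mul_assoc, X, X, monomial_mul, C_mul_monomial]; simp
      rw [this, coeff_monomial]
      refine if_congr ?_ rfl rfl
      rw [Finsupp.single_add_single_eq_single_add_single one_ne_zero one_ne_zero]
      simp
    rw [matrixForm, coeff_sum]
    simp only [coeff_sum, h1]
    by_cases hab : a = b
    · subst hab
      rw [Finset.sum_eq_single a, Finset.sum_eq_single a]
      · simp [quadFormMatrix, ← Finsupp.single_add]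
      all_goals simp +contextual
    -- The mixed coefficient is collected from the two positions (a, b) and (b, a), each carrying
    -- half of it.
    · have h2 : ∀ i j, (if (i = a ∧ j = b) ∨ (i = b ∧ j = a) then quadFormMatrix Q i j else 0) =
          (if i = a then if j = b then quadFormMatrix Q a b else 0 else 0) +
          (if i = b then if j = a then quadFormMatrix Q b a else 0 else 0) := fun i j => by
        by_cases h1 : i = a <;> by_cases h2 : i = b <;> by_cases h3 : j = a <;>
          by_cases h4 : j = b <;> simp_all
      simp only [h2, Finset.sum_add_distrib]
      simp [quadFormMatrix, hab, Ne.symm hab, add_comm (Finsupp.single b 1)]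
  · rw [hQ.coeff_eq_zero hm, (matrixForm_isHomogeneous _).coeff_eq_zero hm]

theorem quadFormMatrix_isSymm {n : ℕ} (Q : MvPolynomial (Fin n) ℚ) :
    (quadFormMatrix Q).IsSymm := by
  ext i j
  simp only [quadFormMatrix, Matrix.transpose_apply, Matrix.of_apply, eq_comm (a := j),
    add_comm (Finsupp.single j 1)]
  split_ifs with h
  · rw [h]
  · rfl

/-- A symmetric matrix over a field of characteristic not two is congruent to a diagonal one. -/
theorem Matrix.IsSymm.exists_diagonal {n : ℕ} {K : Type*} [Field K] [Invertible (2 : K)]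
    {M : Matrix (Fin n) (Fin n) K} (hM : M.IsSymm) :
    ∃ (T : GL (Fin n) K) (w : Fin n → K),
      (T : Matrix (Fin n) (Fin n) K).transpose * M * T = Matrix.diagonal w := by
  have hs : LinearMap.IsSymm (Matrix.toBilin' M) := by
    refine ⟨fun x y => ?_⟩
    rw [RingHom.id_apply, Matrix.toBilin'_apply', Matrix.toBilin'_apply', Matrix.dotProduct_mulVec,
      dotProduct_comm, ← Matrix.mulVec_transpose, hM.eq]
  obtain ⟨v, hv⟩ := LinearMap.BilinForm.exists_orthogonal_basis hs
  let v' := v.reindex (finCongr (by simp : Module.finrank K (Fin n → K) = n))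
  have hv' : ∀ i j, i ≠ j → Matrix.toBilin' M (v' i) (v' j) = 0 := fun i j hij => by
    simp only [v', Module.Basis.reindex_apply]
    exact hv fun h => hij (by simpa using h)
  let P := (Pi.basisFun K (Fin n)).toMatrix v'
  have : Invertible P := (Pi.basisFun K (Fin n)).invertibleToMatrix v'
  refine ⟨unitOfInvertible P, fun k => Matrix.toBilin' M (v' k) (v' k), ?_⟩
  have : ∀ i j, (P.transpose * M * P) i j = Matrix.toBilin' M (v' i) (v' j) := fun i j => by
    have hP : ∀ k, P.col k = v' k := fun k => by
      ext l; simp [P, Module.Basis.toMatrix_apply]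
    rw [Matrix.toBilin'_apply', ← hP, ← hP]
    simp [Matrix.mul_apply, dotProduct, Matrix.mulVec, Finset.sum_mul, Finset.mul_sum, mul_assoc]
    rw [Finset.sum_comm]
  ext i j
  rw [Matrix.diagonal_apply]
  split_ifs with h
  · subst h; exact this i i
  · exact (this i j).trans (hv' i j h)

theorem exists_diagonalForm {n : ℕ} {Q : MvPolynomial (Fin n) ℚ} (hQ : Q.IsHomogeneous 2) :
    ∃ (T : GL (Fin n) ℚ) (w : Fin n → ℚ),
      linearSubstHom (T : Matrix (Fin n) (Fin n) ℚ) Q = ∑ k, C (w k) * X k ^ 2 ∧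
      quadFormRank Q = Fintype.card {k // w k ≠ 0} := by
  have : Invertible (2 : ℚ) := invertibleOfNonzero two_ne_zero
  obtain ⟨T, w, h⟩ := (quadFormMatrix_isSymm Q).exists_diagonal
  refine ⟨T, w, ?_, ?_⟩
  · conv_lhs => rw [eq_matrixForm hQ]
    rw [linearSubstHom_matrixForm, h, matrixForm_diagonal]
  · rw [← Matrix.rank_diagonal, ← h, Matrix.rank_mul_eq_left_of_isUnit_det,
      Matrix.rank_mul_eq_right_of_isUnit_det, quadFormRank]
    · rw [Matrix.det_transpose]; exact (Matrix.isUnit_iff_isUnit_det _).1 T.isUnit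
    · exact (Matrix.isUnit_iff_isUnit_det _).1 T.isUnit

/-! ### Splitting off a hyperbolic plane; quadrics of rank at least five are factorial -/

section SplitHyperbolicPlane

variable {τ K : Type*} [Field K]

/-- The substitution turning `(a x)² - (b y)²` into `x y`. -/
def hyperbolicSubst {a b : K} (ha : a ≠ 0) (hb : b ≠ 0) (h2 : (2 : K) ≠ 0) :
    MvPolynomial (Option (Option τ)) K ≃ₐ[K] MvPolynomial (Option (Option τ)) K :=
  AlgEquiv.ofAlgHom
    (aeval fun o => o.elim (C (2 * a)⁻¹ * (X none + X (some none))) fun o =>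
      o.elim (C (2 * b)⁻¹ * (X none - X (some none))) fun k => X (some (some k)))
    (aeval fun o => o.elim (C a * X none + C b * X (some none)) fun o =>
      o.elim (C a * X none - C b * X (some none)) fun k => X (some (some k)))
    (by
      ext1 o
      have h1 : C a * C (2 * a)⁻¹ + C a * C (2 * a)⁻¹ =
          (1 : MvPolynomial (Option (Option τ)) K) := by
        rw [← C_mul, ← C_add, ← C_1]; congr 1; field_simp; norm_num
      have h3 : C a * C (2 * a)⁻¹ =
          (C b * C (2 * b)⁻¹ : MvPolynomial (Option (Option τ)) K) := by
        rw [← C_mul, ← C_mul]; congr 1; field_simp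
      rcases o with _ | _ | k
      · simp only [AlgHom.comp_apply, aeval_X, Option.elim, map_add, map_mul, algHom_C,
          algebraMap_eq, AlgHom.id_apply]
        linear_combination X none * h1 + (X (some none) - X none) * h3
      · simp only [AlgHom.comp_apply, aeval_X, Option.elim, map_sub, map_mul, algHom_C,
          algebraMap_eq, AlgHom.id_apply]
        linear_combination X (some none) * h1 + (X none - X (some none)) * h3
      · simp)
    (by
      ext1 o
      have h1 : C (2 * a)⁻¹ * C a + C (2 * a)⁻¹ * C a =
          (1 : MvPolynomial (Option (Option τ)) K) := by
        rw [← C_mul, ← C_add, ← C_1]; congr 1; field_simp; norm_num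
      have h3 : C (2 * b)⁻¹ * C b + C (2 * b)⁻¹ * C b =
          (1 : MvPolynomial (Option (Option τ)) K) := by
        rw [← C_mul, ← C_add, ← C_1]; congr 1; field_simp; norm_num
      rcases o with _ | _ | k
      · simp only [AlgHom.comp_apply, aeval_X, Option.elim, map_add, map_mul, algHom_C,
          algebraMap_eq, AlgHom.id_apply]
        linear_combination X none * h1
      · simp only [AlgHom.comp_apply, aeval_X, Option.elim, map_sub, map_mul, algHom_C,
          algebraMap_eq, AlgHom.id_apply]
        linear_combination X (some none) * h3
      · simp)

/-- The isomorphism with `K[x][u][v]` that turns `w₀ x₀² + w₁ x₁² + q(x)` into `u v + q(x)`, where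
`w₀ = a²` and `w₁ = -b²`. -/
def hyperbolicEquiv {a b : K} (ha : a ≠ 0) (hb : b ≠ 0) (h2 : (2 : K) ≠ 0) :
    MvPolynomial (Option (Option τ)) K ≃ₐ[K] Polynomial (Polynomial (MvPolynomial τ K)) :=
  (hyperbolicSubst ha hb h2).trans
    ((optionEquivLeft K (Option τ)).trans (Polynomial.mapAlgEquiv (optionEquivLeft K τ)))

theorem hyperbolicEquiv_diagonal [Fintype τ] {a b : K} (ha : a ≠ 0) (hb : b ≠ 0) (h2 : (2 : K) ≠ 0)
    (w : Option (Option τ) → K) (hwa : w none = a ^ 2) (hwb : w (some none) = -b ^ 2) :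
    hyperbolicEquiv ha hb h2 (∑ k, C (w k) * X k ^ 2) =
      hyperbolicPoly (∑ k, C (w (some (some k))) * X k ^ 2) := by
  have h : hyperbolicSubst ha hb h2 (∑ k, C (w k) * X k ^ 2) =
      X none * X (some none) + ∑ k : τ, C (w (some (some k))) * X (some (some k)) ^ 2 := by
    have h1 : C (a ^ 2) * C (2 * a)⁻¹ ^ 2 = (C (1 / 4) : MvPolynomial (Option (Option τ)) K) := by
      have : (4 : K) ≠ 0 := by
        rw [show (4 : K) = 2 * 2 by norm_num]; exact mul_ne_zero h2 h2
      rw [← C_pow, ← C_mul]; congr 1; field_simp; norm_num [this]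
    have h3 : C (b ^ 2) * C (2 * b)⁻¹ ^ 2 = (C (1 / 4) : MvPolynomial (Option (Option τ)) K) := by
      have : (4 : K) ≠ 0 := by
        rw [show (4 : K) = 2 * 2 by norm_num]; exact mul_ne_zero h2 h2
      rw [← C_pow, ← C_mul]; congr 1; field_simp; norm_num [this]
    have h4 : 4 * C (1 / 4) = (1 : MvPolynomial (Option (Option τ)) K) := by
      rw [← C_1, show (4 : MvPolynomial (Option (Option τ)) K) = C 4 from (map_ofNat C 4).symm,
        ← C_mul]
      congr 1
      have : (4 : K) ≠ 0 := by
        rw [show (4 : K) = 2 * 2 by norm_num]; exact mul_ne_zero h2 h2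
      field_simp
    rw [hyperbolicSubst, AlgEquiv.ofAlgHom_apply, Fintype.sum_option, Fintype.sum_option]
    simp only [map_add, map_sum, map_mul, map_pow, aeval_X, algHom_C, algebraMap_eq, Option.elim,
      hwa, hwb, map_neg]
    simp only [← C_pow]
    rw [← add_assoc]
    congr 1
    simp only [C_pow] at h1 h3 ⊢
    -- This is ((u + v)² - (u - v)²)/4 = uv.
    linear_combination (X none + X (some none)) ^ 2 * h1 - (X none - X (some none)) ^ 2 * h3 +
      X none * X (some none) * h4
  rw [hyperbolicEquiv, AlgEquiv.trans_apply, h, hyperbolicPoly, mul_comm]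
  simp only [AlgEquiv.trans_apply, map_add, map_mul, map_sum, map_pow, optionEquivLeft_X_none,
    optionEquivLeft_X_some, optionEquivLeft_C, Polynomial.coe_mapAlgEquiv, Polynomial.map_X,
    Polynomial.map_C, RingHom.coe_coe]

end SplitHyperbolicPlane

theorem map_linearSubstHom {ι R S : Type*} [Fintype ι] [CommRing R] [CommRing S] (f : R →+* S)
    (T : Matrix ι ι R) (F : MvPolynomial ι R) :
    map f (linearSubstHom T F) = linearSubstHom (T.map f) (map f F) := by
  induction F using MvPolynomial.induction_on with
  | C a => simp [linearSubstHom]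
  | add p q hp hq => simp only [map_add, hp, hq]
  | mul_X p i hp => simp only [map_mul, hp, map_X]; congr 1; simp [linearSubstHom]

theorem nonempty_quotient_span_ringEquiv {R S : Type*} [CommRing R] [CommRing S] (e : R ≃+* S) {x : R} :
    Nonempty (R ⧸ Ideal.span {x} ≃+* S ⧸ Ideal.span {e x}) :=
  ⟨Ideal.quotientEquiv _ _ e (by rw [Ideal.map_span, Set.image_singleton]; rfl)⟩

/-- Five nonzero squares are spent as 2 + 3: over an algebraically closed field two of them form the
product uv, and the other three make the remaining form q prime, as Nagata's criterion for uv + q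
requires. -/
theorem prime_and_ufm_of_diagonal {n : ℕ} {K : Type*} [Field K] [IsAlgClosed K]
    (h2 : (2 : K) ≠ 0) (w : Fin n → K) (f : Fin 5 → Fin n) (hfi : Function.Injective f)
    (hw : ∀ r, w (f r) ≠ 0) :
    IsDomain (MvPolynomial (Fin n) K ⧸ Ideal.span {∑ k, C (w k) * X k ^ 2}) ∧
      UniqueFactorizationMonoid (MvPolynomial (Fin n) K ⧸ Ideal.span {∑ k, C (w k) * X k ^ 2}) := by
  have hf : ∀ r s, r ≠ s → f r ≠ f s := fun r s hrs h => hrs (hfi h)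
  let i : Fin n := f 0
  let j : {k // k ≠ i} := ⟨f 1, hf 1 0 (by decide)⟩
  let τ := {k : {k // k ≠ i} // k ≠ j}
  let e : Option (Option τ) ≃ Fin n :=
    (Equiv.optionCongr (Equiv.optionSubtypeNe j)).trans (Equiv.optionSubtypeNe i)
  have hei : e none = i := by simp [e]
  have hej : e (some none) = j := by simp [e]
  have hek : ∀ k : τ, e (some (some k)) = k.1.1 := fun k => by simp [e]
  obtain ⟨a, ha⟩ := IsAlgClosed.exists_pow_nat_eq (w i) two_pos
  obtain ⟨b, hb⟩ := IsAlgClosed.exists_pow_nat_eq (-w j) two_pos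
  have ha0 : a ≠ 0 := fun h => hw 0 (by rw [← ha, h]; simp)
  have hb0 : b ≠ 0 := fun h => hw 1 (by
    have : w j = -b ^ 2 := by rw [hb, neg_neg]
    rw [show w (f 1) = w j from rfl, this, h]; simp)
  let q : MvPolynomial τ K := ∑ k, C (w (e (some (some k)))) * X k ^ 2
  have hq : Prime q := by
    let t : {r : Fin 5 // r ≠ 0 ∧ r ≠ 1} → τ := fun r =>
      ⟨⟨f r, hf r 0 r.2.1⟩, fun h => hf r 1 r.2.2 (congrArg Subtype.val h)⟩
    have ht : ∀ r s, r ≠ s → t r ≠ t s := fun r s hrs h =>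
      hrs (Subtype.ext (hfi (congrArg (fun x : τ => x.1.1) h)))
    refine prime_sum_mul_X_sq _ h2 (i := t ⟨2, by decide⟩) (j := t ⟨3, by decide⟩)
      (k := t ⟨4, by decide⟩) (ht _ _ (by decide)) (ht _ _ (by decide)) (ht _ _ (by decide))
      ?_ ?_ ?_
    all_goals rw [hek]; exact hw _
  let E := (renameEquiv K e.symm).trans (hyperbolicEquiv (τ := τ) ha0 hb0 h2)
  have hE : E (∑ k, C (w k) * X k ^ 2) = hyperbolicPoly q := by
    have h1 : renameEquiv K e.symm (∑ k, C (w k) * X k ^ 2) =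
        ∑ k, C (w (e k)) * X k ^ 2 := by
      rw [← e.sum_comp]
      simp
    rw [AlgEquiv.trans_apply, h1]
    exact hyperbolicEquiv_diagonal ha0 hb0 h2 (fun k => w (e k)) (by rw [hei, ha])
      (by rw [hej, hb, neg_neg])
  obtain ⟨φ⟩ := nonempty_quotient_span_ringEquiv
    (S := Polynomial (Polynomial (MvPolynomial τ K))) E.toRingEquiv (x := ∑ k, C (w k) * X k ^ 2)
  rw [show E.toRingEquiv (∑ k, C (w k) * X k ^ 2) = hyperbolicPoly q from hE] at φ
  have := hyperbolicQuotient_isDomain hq.ne_zero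
  have := hyperbolicQuotient_ufm hq
  exact ⟨φ.toMulEquiv.isDomain _, φ.symm.toMulEquiv.uniqueFactorizationMonoid this⟩

/-- The homogeneous coordinate ring of a quadric of rank at least five is a factorial domain. -/
theorem quadric_isDomain_and_ufm {n : ℕ} {K : Type*} [Field K] [IsAlgClosed K] [Algebra ℚ K]
    {Q : MvPolynomial (Fin n) ℚ} (hQ : Q.IsHomogeneous 2) (hrank : 5 ≤ quadFormRank Q) :
    IsDomain (MvPolynomial (Fin n) K ⧸ Ideal.span {map (algebraMap ℚ K) Q}) ∧
      UniqueFactorizationMonoid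
        (MvPolynomial (Fin n) K ⧸ Ideal.span {map (algebraMap ℚ K) Q}) := by
  have : CharZero K := algebraRat.charZero K
  obtain ⟨T, w, hT, hw⟩ := exists_diagonalForm hQ
  let T' : GL (Fin n) K := Matrix.GeneralLinearGroup.map (algebraMap ℚ K) T
  have h : linearSubstEquiv T' (map (algebraMap ℚ K) Q) =
      ∑ k, C (algebraMap ℚ K (w k)) * X k ^ 2 := by
    have h1 := congrArg (map (algebraMap ℚ K)) hT
    rw [map_linearSubstHom] at h1
    refine Eq.trans ?_ (h1.trans (by simp))
    rfl
  obtain ⟨f⟩ : Nonempty (Fin 5 ↪ {k // w k ≠ 0}) :=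
    Function.Embedding.nonempty_of_card_le (by rw [← hw]; simpa using hrank)
  obtain ⟨h3, h4⟩ := prime_and_ufm_of_diagonal (K := K) two_ne_zero
    (fun k => algebraMap ℚ K (w k)) (fun r => f r)
    (fun r s h => f.injective (Subtype.ext h))
    (fun r => by simpa only [ne_eq, map_eq_zero] using (f r).2)
  obtain ⟨φ⟩ := nonempty_quotient_span_ringEquiv (linearSubstEquiv T').toRingEquiv
    (x := map (algebraMap ℚ K) Q)
  rw [show (linearSubstEquiv T').toRingEquiv (map (algebraMap ℚ K) Q) = _ from h] at φ
  exact ⟨φ.toMulEquiv.isDomain _, φ.symm.toMulEquiv.uniqueFactorizationMonoid h4⟩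

/-! ### Divisibility between forms modulo a quadric -/

theorem prod_dvd_of_irreducible {R Φ : Type*} [CommRing R] [IsDomain R]
    [UniqueFactorizationMonoid R] [Fintype Φ] {p : Φ → R} {x : R} (hp : ∀ φ, Irreducible (p φ))
    (hinj : ∀ φ ψ, p φ ∣ p ψ → φ = ψ) (h : ∀ φ, p φ ∣ x) : ∏ φ, p φ ∣ x := by
  refine Finset.prod_dvd_of_isRelPrime (fun φ _ ψ _ hne => ?_) fun φ _ => h φ
  exact ((hp φ).isRelPrime_iff_not_dvd).2 fun hd => hne (hinj φ ψ hd)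

section FactorsModuloForm

variable {ι K : Type*} [Field K]

theorem homogeneousComponent_mul_left {P : MvPolynomial ι K} {d : ℕ} (hP : P.IsHomogeneous d)
    (M : MvPolynomial ι K) (m : ℕ) :
    homogeneousComponent m (P * M) = if d ≤ m then P * homogeneousComponent (m - d) M else 0 := by
  have := DirectSum.coe_decompose_mul_of_left_mem (homogeneousSubmodule ι K) (b := M) m
    ((mem_homogeneousSubmodule d P).2 hP)
  rw [← decomposition.decompose'_apply, ← decomposition.decompose'_apply]
  exact this

/-- Taking degree-`m` parts makes the cofactors homogeneous. A generator of degree above `m` drops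
out, which is how memberships in low degree are ruled out. -/
theorem homogeneous_of_eq_mul_add_mul {F P M q E : MvPolynomial ι K} {m d e : ℕ}
    (hF : F.IsHomogeneous m) (hP : P.IsHomogeneous d) (hq : q.IsHomogeneous e)
    (h : F = P * M + q * E) :
    F = (if d ≤ m then P * homogeneousComponent (m - d) M else 0) +
      if e ≤ m then q * homogeneousComponent (m - e) E else 0 := by
  rw [← homogeneousComponent_mul_left hP, ← homogeneousComponent_mul_left hq, ← map_add, ← h,
    homogeneousComponent_of_mem hF, if_pos rfl]

theorem mk_dvd_mk_iff {R : Type*} [CommRing R] {q a b : R} :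
    Ideal.Quotient.mk (Ideal.span {q}) a ∣ Ideal.Quotient.mk (Ideal.span {q}) b ↔
      ∃ M E, b = a * M + q * E := by
  constructor
  · rintro ⟨x, hx⟩
    obtain ⟨x, rfl⟩ := Ideal.Quotient.mk_surjective x
    rw [← map_mul, Ideal.Quotient.eq, Ideal.mem_span_singleton] at hx
    obtain ⟨E, hE⟩ := hx
    exact ⟨x, E, by rw [← hE]; ring⟩
  · rintro ⟨M, E, rfl⟩
    refine ⟨Ideal.Quotient.mk _ M, ?_⟩
    rw [← map_mul, Ideal.Quotient.eq, Ideal.mem_span_singleton]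
    exact ⟨E, by ring⟩

variable {q : MvPolynomial ι K}

theorem not_dvd_of_isHomogeneous_lt {F : MvPolynomial ι K} {m e : ℕ} (hF : F.IsHomogeneous m)
    (hq : q.IsHomogeneous e) (hm : m < e) (hF0 : F ≠ 0) : ¬ q ∣ F := by
  rintro ⟨E, hE⟩
  have := homogeneous_of_eq_mul_add_mul (M := 0) (E := E) hF hF hq (by rw [mul_zero, zero_add, hE])
  rw [if_neg (by omega : ¬ e ≤ m)] at this
  simp at this
  exact hF0 this

/-- Everything in the ideal (F, q) has constant term 0, so 1 is not in it. -/
theorem mk_not_isUnit {F : MvPolynomial ι K} {m e : ℕ} (hF : F.IsHomogeneous m) (hm : m ≠ 0)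
    (hq : q.IsHomogeneous e) (he : e ≠ 0) : ¬ IsUnit (Ideal.Quotient.mk (Ideal.span {q}) F) := by
  rw [isUnit_iff_dvd_one, ← map_one (Ideal.Quotient.mk _), mk_dvd_mk_iff]
  rintro ⟨M, E, h⟩
  have h0 : ∀ {G : MvPolynomial ι K} {k}, G.IsHomogeneous k → k ≠ 0 → constantCoeff G = 0 :=
    fun hG hk => hG.coeff_eq_zero (by simpa using hk.symm)
  have := congrArg constantCoeff h
  simp [h0 hF hm, h0 hq he] at this

/-- In a factorisation of a form modulo `q` into nonunits, the factors are forms of positive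
degree. -/
theorem exists_factors_of_not_irreducible {m e : ℕ} [IsDomain (MvPolynomial ι K ⧸ Ideal.span {q})]
    (hq : q.IsHomogeneous e) (he : e ≠ 0) {F : MvPolynomial ι K} (hF : F.IsHomogeneous m)
    (hm : m ≠ 0) (hqF : ¬ q ∣ F) (hirr : ¬ Irreducible (Ideal.Quotient.mk (Ideal.span {q}) F)) :
    ∃ (a b : ℕ) (A B E : MvPolynomial ι K), 0 < a ∧ 0 < b ∧ a + b = m ∧ A.IsHomogeneous a ∧
      B.IsHomogeneous b ∧ F = A * B + q * E := by
  have hprime : (Ideal.span {q}).IsPrime := (Ideal.Quotient.isDomain_iff_prime _).1 ‹_›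
  rw [irreducible_iff, not_and_or] at hirr
  replace hirr := hirr.resolve_left (not_not.2 (mk_not_isUnit hF hm hq he))
  push Not at hirr
  obtain ⟨A, B, hAB, hA, hB⟩ := hirr
  obtain ⟨A, rfl⟩ := Ideal.Quotient.mk_surjective A
  obtain ⟨B, rfl⟩ := Ideal.Quotient.mk_surjective B
  rw [← map_mul] at hAB
  obtain ⟨a, b, hab, ha, hb⟩ := exists_homogeneous_factors (isHomogeneous_span_singleton hq) hF
    (by rwa [Ideal.mem_span_singleton]) ((Ideal.Quotient.eq).1 hAB.symm)
  rw [← Ideal.Quotient.eq] at ha hb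
  -- Nonzero constants are units, so a nonunit factor of degree 0 would be zero and F would vanish
  -- modulo q.
  have h0 : ∀ G : MvPolynomial ι K, ¬ IsUnit (Ideal.Quotient.mk (Ideal.span {q})
      (homogeneousComponent 0 G)) → Ideal.Quotient.mk (Ideal.span {q})
        (homogeneousComponent 0 G) = 0 := fun G hG => by
    by_contra h
    exact hG ((isUnit_of_isHomogeneous_zero (homogeneousComponent_isHomogeneous 0 G)
      fun h' => h (by rw [h', map_zero])).map _)
  have hF0 : Ideal.Quotient.mk (Ideal.span {q}) F ≠ 0 := by
    rwa [Ne, Ideal.Quotient.eq_zero_iff_dvd]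
  rw [map_mul] at hAB
  have h1 : Ideal.Quotient.mk (Ideal.span {q}) (F) =
    Ideal.Quotient.mk (Ideal.span {q}) (homogeneousComponent a A * homogeneousComponent b B) := by
    rw [hAB, ha, hb, map_mul]
  rw [Ideal.Quotient.eq, Ideal.mem_span_singleton] at h1
  obtain ⟨E, hE⟩ := h1
  refine ⟨a, b, homogeneousComponent a A, homogeneousComponent b B, E, ?_, ?_, hab,
    homogeneousComponent_isHomogeneous _ _, homogeneousComponent_isHomogeneous _ _,
    by rw [← hE]; ring⟩
  · rw [Nat.pos_iff_ne_zero]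
    rintro rfl
    rw [ha] at hA hAB
    exact hF0 (by rw [hAB, h0 A hA, zero_mul])
  · rw [Nat.pos_iff_ne_zero]
    rintro rfl
    rw [hb] at hB hAB
    exact hF0 (by rw [hAB, h0 B hB, mul_zero])

/-- The ideal is the preimage of a principal prime ideal of the quotient by q. -/
theorem isPrime_span_pair_of_prime {R : Type*} [CommRing R] {q F : R}
    (h : Prime (Ideal.Quotient.mk (Ideal.span {q}) F)) : (Ideal.span {F, q}).IsPrime := by
  have h1 := (Ideal.span_singleton_prime h.ne_zero).2 h
  have h2 := h1.comap (Ideal.Quotient.mk (Ideal.span {q}))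
  convert h2 using 1
  ext x
  rw [Ideal.mem_comap, Ideal.mem_span_singleton, mk_dvd_mk_iff, Ideal.mem_span_pair]
  exact ⟨fun ⟨a, b, h⟩ => ⟨a, b, by rw [← h]; ring⟩, fun ⟨a, b, h⟩ => ⟨a, b, by rw [h]; ring⟩⟩

/-- Modulo a factorial quadric, a cubic form either is prime or has a linear factor. -/
theorem isPrime_span_pair_or_exists_linear_factor
    [IsDomain (MvPolynomial ι K ⧸ Ideal.span {q})]
    [UniqueFactorizationMonoid (MvPolynomial ι K ⧸ Ideal.span {q})]
    (hq : q.IsHomogeneous 2) {F : MvPolynomial ι K} (hF : F.IsHomogeneous 3) (hqF : ¬ q ∣ F) :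
    (Ideal.span {F, q}).IsPrime ∨ ∃ L : MvPolynomial ι K, L.IsHomogeneous 1 ∧ L ≠ 0 ∧
      Ideal.Quotient.mk (Ideal.span {q}) L ∣ Ideal.Quotient.mk (Ideal.span {q}) F := by
  by_cases hirr : Irreducible (Ideal.Quotient.mk (Ideal.span {q}) F)
  · exact Or.inl (isPrime_span_pair_of_prime
      (UniqueFactorizationMonoid.irreducible_iff_prime.1 hirr))
  · right
    obtain ⟨a, b, A, B, E, ha, hb, hab, hA, hB, h⟩ :=
      exists_factors_of_not_irreducible hq two_ne_zero hF three_ne_zero hqF hirr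
    obtain rfl | rfl : a = 1 ∨ b = 1 := by omega
    · refine ⟨A, hA, fun h0 => hqF ⟨E, by rw [h, h0]; ring⟩, ?_⟩
      exact mk_dvd_mk_iff.2 ⟨B, E, h⟩
    · refine ⟨B, hB, fun h0 => hqF ⟨E, by rw [h, h0]; ring⟩, ?_⟩
      exact mk_dvd_mk_iff.2 ⟨A, E, by rw [h]; ring⟩

variable [Fintype ι]

theorem linearForm_ne_zero {c : ι → K} {i : ι} (hc : c i ≠ 0) : linearForm c ≠ 0 := fun h =>
  hc (by rw [← coeff_linearForm c i, h, coeff_zero])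

/-- The degree 1 is not a sum of two positive degrees. -/
theorem irreducible_mk_linearForm [IsDomain (MvPolynomial ι K ⧸ Ideal.span {q})]
    (hq : q.IsHomogeneous 2) {c : ι → K} {i : ι} (hc : c i ≠ 0) :
    Irreducible (Ideal.Quotient.mk (Ideal.span {q}) (linearForm c)) := by
  by_contra hirr
  obtain ⟨a, b, A, B, E, ha, hb, hab, -⟩ :=
    exists_factors_of_not_irreducible hq two_ne_zero (linearForm_isHomogeneous c) one_ne_zero
      (not_dvd_of_isHomogeneous_lt (linearForm_isHomogeneous c) hq one_lt_two
        (linearForm_ne_zero hc)) hirr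
  omega

/-- The quadric contributes nothing in degree 1, so the two linear forms are proportional; the
common coefficient 1 fixes the ratio. -/
theorem eq_of_mk_linearForm_dvd (hq : q.IsHomogeneous 2) {c c' : ι → K} {i : ι} (hc : c i = 1)
    (hc' : c' i = 1) (h : Ideal.Quotient.mk (Ideal.span {q}) (linearForm c) ∣
      Ideal.Quotient.mk (Ideal.span {q}) (linearForm c')) : c = c' := by
  obtain ⟨M, E, h⟩ := mk_dvd_mk_iff.1 h
  have h1 := homogeneous_of_eq_mul_add_mul (linearForm_isHomogeneous c')
    (linearForm_isHomogeneous c) hq h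
  rw [if_pos le_rfl, if_neg (by norm_num), add_zero, Nat.sub_self, homogeneousComponent_zero] at h1
  have h2 : ∀ j, c' j = c j * coeff 0 M := fun j => by
    rw [← coeff_linearForm c' j, h1, mul_comm, coeff_C_mul, coeff_linearForm, mul_comm]
  have h3 := h2 i
  rw [hc, hc', one_mul] at h3
  ext j
  rw [h2 j, ← h3, mul_one]

theorem mk_prod_linearForm_dvd [IsDomain (MvPolynomial ι K ⧸ Ideal.span {q})]
    [UniqueFactorizationMonoid (MvPolynomial ι K ⧸ Ideal.span {q})]
    (hq : q.IsHomogeneous 2) {Φ : Type*} [Fintype Φ] {c : Φ → ι → K} (hc : Function.Injective c)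
    {i : ι} (hi : ∀ φ, c φ i = 1) {F : MvPolynomial ι K}
    (h : ∀ φ, Ideal.Quotient.mk (Ideal.span {q}) (linearForm (c φ)) ∣
      Ideal.Quotient.mk (Ideal.span {q}) F) :
    Ideal.Quotient.mk (Ideal.span {q}) (∏ φ, linearForm (c φ)) ∣
      Ideal.Quotient.mk (Ideal.span {q}) F := by
  rw [map_prod]
  exact prod_dvd_of_irreducible
    (fun φ => irreducible_mk_linearForm hq (i := i) (by rw [hi]; exact one_ne_zero))
    (fun φ ψ hd => hc (eq_of_mk_linearForm_dvd hq (hi φ) (hi ψ) hd)) h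

end FactorsModuloForm

/-! ### Descent to the ground field and norms of linear factors -/

section Retraction

variable {ι k K : Type*} [Field k] [Field K] [Algebra k K]

theorem exists_linear_retraction (k K : Type*) [Field k] [Field K] [Algebra k K] :
    ∃ ρ : K →ₗ[k] k, ∀ a, ρ (algebraMap k K a) = a := by
  obtain ⟨ρ, hρ⟩ := LinearMap.exists_leftInverse_of_injective (Algebra.linearMap k K)
    (LinearMap.ker_eq_bot.2 (algebraMap k K).injective)
  exact ⟨ρ, fun a => LinearMap.congr_fun hρ a⟩

/-- Apply a linear map to the coefficients of a polynomial. -/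
def mapCoeff (ρ : K →ₗ[k] k) (F : MvPolynomial ι K) : MvPolynomial ι k :=
  ∑ m ∈ F.support, monomial m (ρ (coeff m F))

theorem coeff_mapCoeff (ρ : K →ₗ[k] k) (F : MvPolynomial ι K) (m : ι →₀ ℕ) :
    coeff m (mapCoeff ρ F) = ρ (coeff m F) := by
  classical
  simp only [mapCoeff, coeff_sum, coeff_monomial, Finset.sum_ite_eq']
  split_ifs with h
  · rfl
  · rw [notMem_support_iff.1 h, map_zero]

/-- The map ρ is only k-linear, not multiplicative; this suffices because the coefficients of `P`
lie in k. -/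
theorem mapCoeff_map_mul (ρ : K →ₗ[k] k) (P : MvPolynomial ι k) (M : MvPolynomial ι K) :
    mapCoeff ρ (map (algebraMap k K) P * M) = P * mapCoeff ρ M := by
  classical
  ext m
  simp only [coeff_mapCoeff, coeff_mul, coeff_map, map_sum, ← Algebra.smul_def, map_smul,
    smul_eq_mul]

theorem mapCoeff_add (ρ : K →ₗ[k] k) (F G : MvPolynomial ι K) :
    mapCoeff ρ (F + G) = mapCoeff ρ F + mapCoeff ρ G := by
  ext m
  simp only [coeff_mapCoeff, coeff_add, map_add]

/-- Ideal membership descends along a field extension. -/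
theorem exists_eq_of_map_eq {F P q : MvPolynomial ι k} {M E : MvPolynomial ι K}
    (h : map (algebraMap k K) F = map (algebraMap k K) P * M + map (algebraMap k K) q * E) :
    ∃ M₀ E₀, F = P * M₀ + q * E₀ := by
  obtain ⟨ρ, hρ⟩ := exists_linear_retraction k K
  refine ⟨mapCoeff ρ M, mapCoeff ρ E, ?_⟩
  rw [← mapCoeff_map_mul, ← mapCoeff_map_mul, ← mapCoeff_add, ← h]
  ext m
  rw [coeff_mapCoeff, coeff_map, hρ]

end Retraction

/-- The columns of `T` form a basis of kⁿ adapted to the kernel of the map to V given by `v`; a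
complement of the kernel embeds in V. Applied to the coefficients of a linear form over a field of
degree `d`, it leaves at most `d` variables. -/
theorem Matrix.exists_generalLinear_card_le {n d : ℕ} {k V : Type*} [Field k] [AddCommGroup V]
    [Module k V] [FiniteDimensional k V] (v : Fin n → V) (hd : Module.finrank k V = d) :
    ∃ (T : GL (Fin n) k) (s : Finset (Fin n)), s.card ≤ d ∧
      ∀ j ∉ s, ∑ i, (T : Matrix (Fin n) (Fin n) k) i j • v i = 0 := by
  classical
  let f : (Fin n → k) →ₗ[k] V := Fintype.linearCombination k v
  obtain ⟨W, hW⟩ := Submodule.exists_isCompl (LinearMap.ker f)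
  let bK := Module.finBasis k (LinearMap.ker f)
  let bW := Module.finBasis k W
  let b := (bK.prod bW).map (Submodule.prodEquivOfIsCompl _ _ hW)
  let e : _ ≃ Fin n := b.indexEquiv (Pi.basisFun k (Fin n))
  let b' := b.reindex e
  have hker : ∀ i, f (b (Sum.inl i)) = 0 := fun i => by
    have : b (Sum.inl i) = bK i := by simp [b]
    rw [this]
    exact (bK i).2
  have hdim : Module.finrank k W ≤ d := by
    have h1 := Submodule.finrank_add_eq_of_isCompl hW
    have h2 := LinearMap.finrank_range_add_finrank_ker f
    have h3 := Submodule.finrank_le (LinearMap.range f)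
    omega
  let P := (Pi.basisFun k (Fin n)).toMatrix b'
  have : Invertible P := (Pi.basisFun k (Fin n)).invertibleToMatrix b'
  refine ⟨unitOfInvertible P, Finset.univ.image fun i => e (Sum.inr i), ?_, ?_⟩
  · exact Finset.card_image_le.trans (by simpa using hdim)
  · intro j hj
    obtain ⟨i | i, rfl⟩ := e.surjective j
    · have h := hker i
      rw [Fintype.linearCombination_apply] at h
      simpa [P, b', Module.Basis.toMatrix_apply] using h
    · exact absurd (Finset.mem_image_of_mem _ (Finset.mem_univ i)) hj

theorem linearSubstHom_linearForm {ι K : Type*} [Fintype ι] [CommRing K] (T : Matrix ι ι K)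
    (c : ι → K) : linearSubstHom T (linearForm c) = linearForm fun j => ∑ i, T i j * c i := by
  simp only [linearSubstHom, linearForm, map_sum, map_mul, algHom_C, aeval_X, algebraMap_eq,
    Finset.mul_sum, Finset.sum_mul]
  rw [Finset.sum_comm]
  exact Finset.sum_congr rfl fun i _ => Finset.sum_congr rfl fun j _ => by ring

theorem vars_linearForm_subset {ι K : Type*} [Fintype ι] [CommRing K] {c : ι → K}
    {s : Finset ι} (h : ∀ j ∉ s, c j = 0) : (linearForm c).vars ⊆ s := by
  classical
  intro j hj
  by_contra hjs
  have h1 : linearForm c = ∑ i ∈ s, C (c i) * X i := by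
    rw [linearForm]
    symm
    exact Finset.sum_subset (Finset.subset_univ _) fun i _ hi => by rw [h i hi]; simp
  rw [h1] at hj
  obtain ⟨i, hi, hij⟩ := Finset.mem_biUnion.1 (vars_sum_subset _ _ hj)
  rw [C_mul_X_eq_monomial] at hij
  by_cases hc : c i = 0
  · rw [hc, monomial_zero, vars_0] at hij
    exact absurd hij (Finset.notMem_empty j)
  · rw [vars_monomial_single i one_ne_zero hc, Finset.mem_singleton] at hij
    exact hjs (hij ▸ hi)

section Norm

variable {k K : Type*} [Field k] [Field K] [Algebra k K]

/-- The Galois group permutes the embeddings, hence fixes every coefficient of the product. -/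
theorem exists_map_eq_prod_embeddings {ι : Type*} [Fintype ι] [IsGalois k K] [IsAlgClosed K]
    (F : IntermediateField k K) [FiniteDimensional k F] (c : ι → F) :
    ∃ P : MvPolynomial ι k, map (algebraMap k K) P =
      ∏ φ : F →ₐ[k] K, linearForm fun i => φ (c i) := by
  rw [← Set.mem_range, mem_range_map_iff_coeffs_subset]
  intro x hx
  obtain ⟨m, -, rfl⟩ := mem_coeffs_iff.1 hx
  rw [← IntermediateField.mem_bot, InfiniteGalois.mem_bot_iff_fixed]
  intro τ
  have h : map (τ : K →+* K) (∏ φ : F →ₐ[k] K, linearForm fun i => φ (c i)) =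
      ∏ φ : F →ₐ[k] K, linearForm fun i => φ (c i) := by
    rw [map_prod]
    simp only [linearForm_map]
    exact Fintype.prod_equiv (AlgEquiv.arrowCongr AlgEquiv.refl τ) _ _ fun φ => by
      simp [AlgEquiv.arrowCongr]
  conv_rhs => rw [← h]
  rw [coeff_map]
  rfl

theorem MvPolynomial.IsHomogeneous.of_map_injective {ι R S : Type*} [CommSemiring R]
    [CommSemiring S] {f : R →+* S} (hf : Function.Injective f) {F : MvPolynomial ι R} {d : ℕ}
    (h : (map f F).IsHomogeneous d) : F.IsHomogeneous d := fun m hm => h (by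
  rw [coeff_map]
  exact fun h0 => hm (hf (by rw [h0, map_zero])))

/-- A linear factor of a form modulo `Q` over the algebraic closure has a norm which is a factor
over the ground field, and which depends on at most as many variables as its degree. -/
theorem exists_norm_factor {n : ℕ} [CharZero k] [IsGalois k K] [IsAlgClosed K]
    {F Q : MvPolynomial (Fin n) k} (hQ : Q.IsHomogeneous 2)
    [IsDomain (MvPolynomial (Fin n) K ⧸ Ideal.span {map (algebraMap k K) Q})]
    [UniqueFactorizationMonoid (MvPolynomial (Fin n) K ⧸ Ideal.span {map (algebraMap k K) Q})]
    {L : MvPolynomial (Fin n) K} (hL : L.IsHomogeneous 1) (hL0 : L ≠ 0)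
    (hLF : Ideal.Quotient.mk (Ideal.span {map (algebraMap k K) Q}) L ∣
      Ideal.Quotient.mk (Ideal.span {map (algebraMap k K) Q}) (map (algebraMap k K) F)) :
    ∃ (d : ℕ) (P M E : MvPolynomial (Fin n) k) (T : GL (Fin n) k), 0 < d ∧ P.IsHomogeneous d ∧
      F = P * M + Q * E ∧
      (linearSubstHom (T : Matrix (Fin n) (Fin n) k) P).vars.card ≤ d := by
  classical
  obtain ⟨M, E, h⟩ := mk_dvd_mk_iff.1 hLF
  obtain ⟨a, ha⟩ : ∃ a, L = linearForm a := ⟨_, hL.eq_linearForm⟩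
  obtain ⟨i, hi⟩ : ∃ i, a i ≠ 0 := by
    by_contra! h0
    exact hL0 (by rw [ha, linearForm]; simp [h0])
  -- With the `i`-th coefficient normalised to 1, conjugates that are distinct are also
  -- non-associate.
  let b : Fin n → K := fun j => a j / a i
  have hb : L = C (a i) * linearForm b := by
    rw [ha, linearForm, linearForm, Finset.mul_sum]
    refine Finset.sum_congr rfl fun j _ => ?_
    rw [← mul_assoc, ← C_mul, mul_div_cancel₀ _ hi]
  -- The field is generated by the coefficients, so distinct embeddings give distinct conjugates of
  -- the linear form.
  let N : IntermediateField k K := IntermediateField.adjoin k (Set.range b)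
  have hN : FiniteDimensional k N := IntermediateField.finiteDimensional_adjoin
    fun x _ => Algebra.IsIntegral.isIntegral x
  let c : Fin n → N := fun j => ⟨b j, IntermediateField.subset_adjoin k _ ⟨j, rfl⟩⟩
  have hci : c i = 1 := Subtype.ext (div_self hi)
  let cφ : (N →ₐ[k] K) → Fin n → K := fun φ j => φ (c j)
  have hinj : Function.Injective cφ := fun φ ψ hφψ => by
    refine IntermediateField.algHom_ext_of_eq_adjoin k (S := N) (s := Set.range b) rfl ?_
    rintro _ ⟨j, rfl⟩
    exact congrFun hφψ j
  have hdvd : ∀ φ, Ideal.Quotient.mk (Ideal.span {map (algebraMap k K) Q}) (linearForm (cφ φ)) ∣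
      Ideal.Quotient.mk (Ideal.span {map (algebraMap k K) Q}) (map (algebraMap k K) F) := fun φ => by
    -- The extension τ of φ fixes `F` and `Q`, so it carries the divisibility by L to its conjugate.
    let τ : K →ₐ[k] K := φ.liftNormal K
    have hτ : ∀ j, τ (b j) = cφ φ j := fun j => φ.liftNormal_commutes K (c j)
    have hmap : ∀ G : MvPolynomial (Fin n) k, map (τ : K →+* K) (map (algebraMap k K) G) =
        map (algebraMap k K) G := fun G => by
      rw [map_map]
      congr 1
      exact congrArg map (τ.comp_algebraMap)
    have h1 := congrArg (map (τ : K →+* K)) h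
    rw [hmap, map_add, map_mul, map_mul, hmap, hb, map_mul, linearForm_map] at h1
    rw [mk_dvd_mk_iff]
    refine ⟨map (τ : K →+* K) (C (a i)) * map (τ : K →+* K) M, map (τ : K →+* K) E, ?_⟩
    rw [h1]
    simp only [RingHom.coe_coe, hτ]
    ring
  have hprod := mk_prod_linearForm_dvd (hQ.map (algebraMap k K)) hinj (i := i)
    (fun φ => by simp [cφ, hci]) hdvd
  obtain ⟨P, hP⟩ := exists_map_eq_prod_embeddings N c
  rw [show ∏ φ, linearForm (cφ φ) = _ from hP.symm, mk_dvd_mk_iff] at hprod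
  obtain ⟨M', E', h'⟩ := hprod
  obtain ⟨M₀, E₀, h₀⟩ := exists_eq_of_map_eq h'
  obtain ⟨T, s, hs, hT⟩ := Matrix.exists_generalLinear_card_le (d := Module.finrank k N) c rfl
  refine ⟨Module.finrank k N, P, M₀, E₀, T, Module.finrank_pos, ?_, h₀, ?_⟩
  · refine IsHomogeneous.of_map_injective (algebraMap k K).injective ?_
    rw [hP, ← AlgHom.card k N K, ← Finset.card_univ, Finset.card_eq_sum_ones]
    exact IsHomogeneous.prod _ _ _ fun φ _ => linearForm_isHomogeneous _
  · refine (Finset.card_le_card ?_).trans hs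
    rw [← vars_map_of_injective _ (algebraMap k K).injective, map_linearSubstHom, hP, map_prod]
    refine (vars_prod _).trans (Finset.biUnion_subset.2 fun φ _ => ?_)
    rw [linearSubstHom_linearForm]
    refine vars_linearForm_subset fun j hj => ?_
    -- The entries of `T` lie in k, so a single substitution removes the same variables from all
    -- conjugates at once.
    have := congrArg φ (hT j hj)
    simpa [Algebra.smul_def] using this

end Norm

/-! ### Using the Q-order and the h-invariant to exclude linear factors -/

section Invariants

variable {n : ℕ} {F Q : MvPolynomial (Fin n) ℚ}

theorem qOrder_le_of_eq {P : MvPolynomial (Fin n) ℚ} (hP : P.IsHomogeneous 3)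
    {E : MvPolynomial (Fin n) ℚ} (hE : E.IsHomogeneous 1) (h : F = P + Q * E) (T : GL (Fin n) ℚ)
    {d : ℕ} (hT : (linearSubstHom (T : Matrix (Fin n) (Fin n) ℚ) P).vars.card ≤ d) :
    qOrder Q F ≤ d := by
  have h1 : qOrder Q F ≤ formOrder P := Nat.sInf_le ⟨P, hP, ⟨E, hE, by rw [h]; ring⟩, rfl⟩
  have h2 : formOrder P ≤ (linearSubstHom (T : Matrix (Fin n) (Fin n) ℚ) P).vars.card :=
    Nat.sInf_le ⟨T, rfl⟩
  exact h1.trans (h2.trans hT)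

theorem hInvariantMod_le_one {a b : ℕ} {A B E : MvPolynomial (Fin n) ℚ} (ha : 0 < a) (hb : 0 < b)
    (hA : A.IsHomogeneous a) (hB : B.IsHomogeneous b) (hE : E.IsHomogeneous 1)
    (h : F = A * B + Q * E) : hInvariantMod Q F ≤ 1 := by
  have h1 : hInvariantMod Q F ≤ hInvariant (F + -E * Q) := Nat.sInf_le ⟨-E, hE.neg, rfl⟩
  have h2 : hInvariant (F + -E * Q) ≤ 1 := Nat.sInf_le
    ⟨one_pos, fun _ => A, fun _ => B, fun _ => ⟨a, ha, hA⟩, fun _ => ⟨b, hb, hB⟩,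
      by rw [h, Fin.sum_univ_one]; ring⟩
  exact h1.trans h2

/-- Otherwise the zero form, of order 0, would be Q-equivalent to `F`. -/
theorem not_dvd_of_qOrder (hF : F.IsHomogeneous 3) (hQ : Q.IsHomogeneous 2)
    (hord : 4 ≤ qOrder Q F) : ¬ Q ∣ F := by
  rintro ⟨E, hE⟩
  have h := homogeneous_of_eq_mul_add_mul (M := 0) (E := E) hF hF hQ
    (by rw [mul_zero, zero_add, hE])
  rw [if_pos le_rfl, map_zero, mul_zero, if_pos (by norm_num)] at h
  have := qOrder_le_of_eq (isHomogeneous_zero _ _ 3) (homogeneousComponent_isHomogeneous 1 E) h 1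
    (d := 0) (by simp)
  omega

theorem not_map_dvd_of_qOrder {K : Type*} [Field K] [Algebra ℚ K] (hF : F.IsHomogeneous 3)
    (hQ : Q.IsHomogeneous 2) (hord : 4 ≤ qOrder Q F) :
    ¬ map (algebraMap ℚ K) Q ∣ map (algebraMap ℚ K) F := by
  rintro ⟨E, hE⟩
  obtain ⟨M₀, E₀, h⟩ := exists_eq_of_map_eq (P := 0) (M := 0) (E := E) (q := Q) (F := F)
    (by rw [mul_zero, zero_add, hE])
  exact not_dvd_of_qOrder hF hQ hord ⟨E₀, by rw [h, zero_mul, zero_add]⟩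

/-- For d < 3, the degree-3 part exhibits `F` as one product plus a multiple of `Q`. For d = 3 the
cofactor of `P` is constant, so `F` is Q-equivalent to a cubic in at most three variables. For d >
3, `P` cannot contribute in degree 3, so `Q` divides `F`. -/
theorem not_linear_factor (hF : F.IsHomogeneous 3) (hQ : Q.IsHomogeneous 2)
    (hord : 4 ≤ qOrder Q F) (hh : 2 ≤ hInvariantMod Q F) {d : ℕ}
    {P M E : MvPolynomial (Fin n) ℚ} (hd : 0 < d) (hP : P.IsHomogeneous d) (h : F = P * M + Q * E)
    (T : GL (Fin n) ℚ) (hT : (linearSubstHom (T : Matrix (Fin n) (Fin n) ℚ) P).vars.card ≤ d) :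
    False := by
  have h1 := homogeneous_of_eq_mul_add_mul hF hP hQ h
  rw [if_pos (by norm_num : 2 ≤ 3)] at h1
  have hE := homogeneousComponent_isHomogeneous 1 E
  obtain hd3 | rfl | hd3 := lt_trichotomy d 3
  · rw [if_pos hd3.le] at h1
    have := hInvariantMod_le_one hd (by omega : 0 < 3 - d) hP
      (homogeneousComponent_isHomogeneous _ M) hE h1
    omega
  · rw [if_pos le_rfl, Nat.sub_self] at h1
    have hM := homogeneousComponent_isHomogeneous 0 M
    have := qOrder_le_of_eq (by simpa using hP.mul hM) hE h1 T (d := 3) (by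
      refine (Finset.card_le_card ?_).trans hT
      classical
      rw [homogeneousComponent_zero, map_mul]
      refine (vars_mul _ _).trans (Finset.union_subset subset_rfl ?_)
      simp [linearSubstHom, algHom_C, algebraMap_eq])
    omega
  · rw [if_neg (by omega), zero_add] at h1
    exact not_dvd_of_qOrder hF hQ hord ⟨_, h1⟩

/-- Under the hypotheses on rank, order and `h`-invariant, the forms generate a prime ideal. -/
theorem isPrime_span_pair (hF : F.IsHomogeneous 3) (hQ : Q.IsHomogeneous 2)
    (hrank : 5 ≤ quadFormRank Q) (hord : 4 ≤ qOrder Q F) (hh : 2 ≤ hInvariantMod Q F) :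
    (Ideal.span {map (algebraMap ℚ (AlgebraicClosure ℚ)) F,
      map (algebraMap ℚ (AlgebraicClosure ℚ)) Q}).IsPrime := by
  obtain ⟨_, _⟩ := quadric_isDomain_and_ufm (K := AlgebraicClosure ℚ) hQ hrank
  have hdvd := not_map_dvd_of_qOrder (K := AlgebraicClosure ℚ) hF hQ hord
  refine (isPrime_span_pair_or_exists_linear_factor (hQ.map _) (hF.map _) hdvd).resolve_right ?_
  rintro ⟨L, hL, hL0, hLF⟩
  -- The ℚ-algebra structures coming from characteristic zero and from the algebraic closure
  -- coincide, since a ring has at most one.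
  have : IsAlgClosure ℚ (AlgebraicClosure ℚ) := by
    rw [Subsingleton.elim (DivisionRing.toRatAlgebra : Algebra ℚ (AlgebraicClosure ℚ))
      (AlgebraicClosure.instAlgebra ℚ)]
    infer_instance
  obtain ⟨d, P, M, E, T, hd, hP, h, hT⟩ := exists_norm_factor hQ hL hL0 hLF
  exact not_linear_factor hF hQ hord hh hd hP h T hT

end Invariants

/-! ### Homogeneous primes, irreducible closed sets and codimension -/

section ProjectiveVarieties

variable {n : ℕ} {K : Type*} [Field K]

/-- The point of projective space given by a homogeneous prime ideal. -/
def projPoint (I : Ideal (MvPolynomial (Fin n) K)) (hI : I.IsPrime)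
    (hh : I.IsHomogeneous (homogeneousSubmodule (Fin n) K)) (i : Fin n) (hi : X i ∉ I) :
    ProjSpace n K where
  asHomogeneousIdeal := ⟨I, hh⟩
  isPrime := hI
  not_irrelevant_le h := hi (h (HomogeneousIdeal.mem_irrelevant_of_mem _ one_pos
    (isHomogeneous_X K i)))

theorem zeroLocus_eq_closure_projPoint {I : Ideal (MvPolynomial (Fin n) K)} (hI : I.IsPrime)
    (hh : I.IsHomogeneous (homogeneousSubmodule (Fin n) K)) {i : Fin n} (hi : X i ∉ I) :
    ProjectiveSpectrum.zeroLocus (homogeneousSubmodule (Fin n) K) (I : Set _) =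
      closure {projPoint I hI hh i hi} := by
  rw [← ProjectiveSpectrum.zeroLocus_vanishingIdeal_eq_closure,
    ProjectiveSpectrum.vanishingIdeal_singleton]
  rfl

/-- No Nullstellensatz is needed: `I` is itself a point of `Proj`, generic in its zero locus. The
variable outside `I` ensures that `I` does not contain the irrelevant ideal. -/
theorem vanishingIdeal_zeroLocus_of_isPrime {I : Ideal (MvPolynomial (Fin n) K)} (hI : I.IsPrime)
    (hh : I.IsHomogeneous (homogeneousSubmodule (Fin n) K)) {i : Fin n} (hi : X i ∉ I) :
    (ProjectiveSpectrum.vanishingIdeal (ProjectiveSpectrum.zeroLocus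
      (homogeneousSubmodule (Fin n) K) (I : Set (MvPolynomial (Fin n) K)))).toIdeal = I := by
  rw [zeroLocus_eq_closure_projPoint hI hh hi, ProjectiveSpectrum.vanishingIdeal_closure,
    ProjectiveSpectrum.vanishingIdeal_singleton]
  rfl

/-- The closed subvariety of projective space given by a homogeneous prime ideal. -/
def projVariety (I : Ideal (MvPolynomial (Fin n) K)) (hI : I.IsPrime)
    (hh : I.IsHomogeneous (homogeneousSubmodule (Fin n) K)) (i : Fin n) (hi : X i ∉ I) :
    TopologicalSpace.IrreducibleCloseds (ProjSpace n K) where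
  carrier := ProjectiveSpectrum.zeroLocus (homogeneousSubmodule (Fin n) K) (I : Set _)
  isIrreducible' := by
    rw [zeroLocus_eq_closure_projPoint hI hh hi]
    exact isIrreducible_singleton.closure
  isClosed' := ProjectiveSpectrum.isClosed_zeroLocus _ _

theorem projVariety_lt {I J : Ideal (MvPolynomial (Fin n) K)} {hI : I.IsPrime} {hJ : J.IsPrime}
    {hhI : I.IsHomogeneous (homogeneousSubmodule (Fin n) K)}
    {hhJ : J.IsHomogeneous (homogeneousSubmodule (Fin n) K)} {i j : Fin n} {hi : X i ∉ I}
    {hj : X j ∉ J} (h : I < J) : projVariety J hJ hhJ j hj < projVariety I hI hhI i hi := by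
  refine lt_of_le_of_ne (ProjectiveSpectrum.zeroLocus_anti_mono_ideal _ h.le) fun he => h.ne ?_
  have h1 := congrArg (fun Z : TopologicalSpace.IrreducibleCloseds (ProjSpace n K) => Z.carrier) he
  rw [← vanishingIdeal_zeroLocus_of_isPrime hI hhI hi,
    ← vanishingIdeal_zeroLocus_of_isPrime hJ hhJ hj]
  exact congrArg (fun Z => (ProjectiveSpectrum.vanishingIdeal Z).toIdeal) h1.symm

theorem vanishingIdeal_isPrime {Z : Set (ProjSpace n K)} (hZ : IsIrreducible Z) :
    (ProjectiveSpectrum.vanishingIdeal Z).toIdeal.IsPrime := by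
  refine ⟨?_, ?_⟩
  · rw [Ne, Ideal.eq_top_iff_one]
    intro h
    obtain ⟨p, hp⟩ := hZ.nonempty
    exact p.isPrime.ne_top ((Ideal.eq_top_iff_one _).2
      ((ProjectiveSpectrum.mem_vanishingIdeal Z 1).1 h p hp))
  · intro x y hxy
    have h1 : ∀ z, z ∈ (ProjectiveSpectrum.vanishingIdeal Z).toIdeal ↔
        Z ⊆ ProjectiveSpectrum.zeroLocus (homogeneousSubmodule (Fin n) K) {z} := fun z => by
      rw [ProjectiveSpectrum.subset_zeroLocus_iff_subset_vanishingIdeal, Set.singleton_subset_iff]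
      rfl
    rw [h1, ProjectiveSpectrum.zeroLocus_singleton_mul] at hxy
    rw [h1, h1]
    exact (isPreirreducible_iff_isClosed_union_isClosed.1 hZ.isPreirreducible) _ _
      (ProjectiveSpectrum.isClosed_zeroLocus _ _) (ProjectiveSpectrum.isClosed_zeroLocus _ _) hxy

/-- Vanishing ideals turn a chain of irreducible closed sets above Z into a chain of primes below
that of Z. Only an inequality results directly, since height also counts chains of inhomogeneous
primes. -/
theorem coheight_le_height_vanishingIdeal
    (Z : TopologicalSpace.IrreducibleCloseds (ProjSpace n K)) :
    Order.coheight Z ≤ (ProjectiveSpectrum.vanishingIdeal (Z : Set (ProjSpace n K))).toIdeal.height := by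
  let f : TopologicalSpace.IrreducibleCloseds (ProjSpace n K) →
      (PrimeSpectrum (MvPolynomial (Fin n) K))ᵒᵈ := fun Y =>
    OrderDual.toDual ⟨_, vanishingIdeal_isPrime Y.isIrreducible⟩
  have hf : StrictMono f := by
    intro Y Y' h
    have hV : ProjectiveSpectrum.vanishingIdeal (Y' : Set (ProjSpace n K)) ≤
        ProjectiveSpectrum.vanishingIdeal (Y : Set (ProjSpace n K)) :=
      fun x hx => (ProjectiveSpectrum.mem_vanishingIdeal _ x).2 fun p hp =>
        (ProjectiveSpectrum.mem_vanishingIdeal _ x).1 hx p (h.le hp)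
    have hle : f Y ≤ f Y' := OrderDual.toDual_le_toDual.2 hV
    refine lt_of_le_of_ne hle fun he => h.ne ?_
    have h1 : ProjectiveSpectrum.vanishingIdeal (Y : Set (ProjSpace n K)) =
        ProjectiveSpectrum.vanishingIdeal (Y' : Set (ProjSpace n K)) :=
      HomogeneousIdeal.toIdeal_injective (congrArg PrimeSpectrum.asIdeal he)
    refine SetLike.coe_injective ?_
    rw [← Y.isClosed.closure_eq, ← Y'.isClosed.closure_eq,
      ← ProjectiveSpectrum.zeroLocus_vanishingIdeal_eq_closure, h1,
      ProjectiveSpectrum.zeroLocus_vanishingIdeal_eq_closure]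
  refine (Order.coheight_le_coheight_apply_of_strictMono f hf Z).trans ?_
  exact (PrimeSpectrum.height_eq_orderHeight (OrderDual.ofDual (f Z))).ge

/-- Coheight is antitone, so the infimum is attained at `Z` itself. -/
theorem codimension_eq_coheight {P : Type*} [TopologicalSpace P]
    (Z : TopologicalSpace.IrreducibleCloseds P) : codimension (Z : Set P) = Order.coheight Z :=
  le_antisymm (iInf₂_le Z (Set.Subset.refl _))
    (le_iInf₂ fun Y hY => Order.coheight_anti (show Y ≤ Z from hY))

variable {F q : MvPolynomial (Fin n) K}

theorem X_notMem_span_pair (hF : F.IsHomogeneous 3) (hq : q.IsHomogeneous 2) (i : Fin n) :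
    X i ∉ Ideal.span {F, q} := by
  rw [Ideal.mem_span_pair]
  rintro ⟨a, b, h⟩
  have := homogeneous_of_eq_mul_add_mul (isHomogeneous_X K i) hF hq (M := a) (E := b)
    (by rw [← h]; ring)
  rw [if_neg (by norm_num), if_neg (by norm_num), add_zero] at this
  exact X_ne_zero i this

theorem isHomogeneous_span_pair (hF : F.IsHomogeneous 3) (hq : q.IsHomogeneous 2) :
    (Ideal.span {F, q}).IsHomogeneous (homogeneousSubmodule (Fin n) K) :=
  Ideal.homogeneous_span _ _ fun x hx => by
    rcases hx with rfl | rfl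
    exacts [⟨3, hF⟩, ⟨2, hq⟩]

/-- Krull's height theorem for two generators bounds the codimension above; the chain V(F, q) ⊂ V(q)
⊂ ℙ bounds it below. -/
theorem codimension_eq_two (hF : F.IsHomogeneous 3) (hq : q.IsHomogeneous 2) (hqp : Prime q)
    (hqF : ¬ q ∣ F) (hI : (Ideal.span {F, q}).IsPrime) (i : Fin n) :
    codimension (ProjectiveSpectrum.zeroLocus (homogeneousSubmodule (Fin n) K) {F, q}) = 2 := by
  have hi := X_notMem_span_pair hF hq i
  have hh := isHomogeneous_span_pair hF hq
  let Z := projVariety _ hI hh i hi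
  have hZ : (Z : Set (ProjSpace n K)) =
      ProjectiveSpectrum.zeroLocus (homogeneousSubmodule (Fin n) K) {F, q} :=
    ProjectiveSpectrum.zeroLocus_span _ _
  rw [← hZ, codimension_eq_coheight]
  apply le_antisymm
  · refine (coheight_le_height_vanishingIdeal Z).trans ?_
    rw [show (ProjectiveSpectrum.vanishingIdeal (Z : Set (ProjSpace n K))).toIdeal =
      Ideal.span {F, q} from vanishingIdeal_zeroLocus_of_isPrime hI hh hi]
    have := Ideal.height_le_card_of_mem_minimalPrimes_span (p := Ideal.span {F, q}) (s := {F, q})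
      (Set.toFinite _) (by rw [Ideal.minimalPrimes_eq_subsingleton_self]; rfl)
    refine this.trans ?_
    exact_mod_cast (Set.ncard_insert_le F {q}).trans (by rw [Set.ncard_singleton])
  · let Zq := projVariety (Ideal.span {q}) ((Ideal.span_singleton_prime hqp.ne_zero).2 hqp)
      (isHomogeneous_span_singleton hq) i
      (by rw [Ideal.mem_span_singleton]; exact not_dvd_of_isHomogeneous_lt
            (isHomogeneous_X K i) hq one_lt_two (X_ne_zero i))
    let Zt := projVariety (⊥ : Ideal (MvPolynomial (Fin n) K)) Ideal.isPrime_bot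
      (Ideal.IsHomogeneous.bot _) i (by rw [Ideal.mem_bot]; exact X_ne_zero i)
    have h1 : Zq < Zt := projVariety_lt (bot_lt_iff_ne_bot.2 (by
      rw [Ne, Ideal.span_singleton_eq_bot]; exact hqp.ne_zero))
    have h2 : Z < Zq := projVariety_lt (lt_of_le_of_ne
      (Ideal.span_mono (by simp)) fun h => hqF (by
        rw [← Ideal.mem_span_singleton, h]; exact Ideal.subset_span (by simp)))
    calc (2 : ℕ∞) = 0 + 1 + 1 := by norm_num
      _ ≤ Order.coheight Zt + 1 + 1 := by gcongr; exact zero_le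
      _ ≤ Order.coheight Zq + 1 := by gcongr; exact Order.coheight_add_one_le h1
      _ ≤ Order.coheight Z := Order.coheight_add_one_le h2

end ProjectiveVarieties

/-! ### The Hilbert function of (F, q) and the degree -/

section HilbertFunction

variable {n : ℕ} {K : Type*} [Field K]

theorem homogeneousSubmodule_eq_span (m : ℕ) : homogeneousSubmodule (Fin n) K m =
    Submodule.span K (Set.range fun d : (Finset.univ : Finset (Fin n)).finsuppAntidiag m =>
      (monomial d.1 1 : MvPolynomial (Fin n) K)) := by
  have hmem : ∀ d : Fin n →₀ ℕ, d ∈ (Finset.univ : Finset (Fin n)).finsuppAntidiag m ↔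
      d.degree = m := fun d => by
    rw [Finset.mem_finsuppAntidiag, Finsupp.degree_eq_sum]
    simp
  apply le_antisymm
  · intro F hF
    rw [F.as_sum]
    refine Submodule.sum_mem _ fun d hd => ?_
    rw [← mul_one (coeff d F), ← smul_eq_mul, ← smul_monomial]
    refine Submodule.smul_mem _ _ (Submodule.subset_span ⟨⟨d, (hmem d).2 ?_⟩, rfl⟩)
    exact (IsHomogeneous.degree_eq_sum_deg_support hF hd).symm
  · rw [Submodule.span_le]
    rintro _ ⟨d, rfl⟩
    exact isHomogeneous_monomial _ ((hmem d.1).1 d.2)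

theorem finrank_homogeneousSubmodule (m : ℕ) :
    Module.finrank K (homogeneousSubmodule (Fin n) K m) = (n + m - 1).choose m := by
  have hli : LinearIndependent K fun d : (Finset.univ : Finset (Fin n)).finsuppAntidiag m =>
      (monomial d.1 1 : MvPolynomial (Fin n) K) := by
    have := (basisMonomials (Fin n) K).linearIndependent.comp
      (fun d : (Finset.univ : Finset (Fin n)).finsuppAntidiag m => d.1) Subtype.val_injective
    simpa [Function.comp_def] using this
  rw [homogeneousSubmodule_eq_span, finrank_span_eq_card hli, Fintype.card_coe,
    Finset.card_finsuppAntidiag_nat_eq_choose, Finset.card_univ, Fintype.card_fin]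

instance finiteDimensional_homogeneousSubmodule (m : ℕ) :
    FiniteDimensional K (homogeneousSubmodule (Fin n) K m) :=
  Module.Finite.iff_fg.2 (homogeneousSubmodule_fg _ _ m)

theorem Submodule.finrank_map_add_finrank_inf_ker {V W : Type*} [AddCommGroup V] [Module K V]
    [AddCommGroup W] [Module K W] (f : V →ₗ[K] W) (p : Submodule K V) [FiniteDimensional K p] :
    Module.finrank K (p.map f) + Module.finrank K (p ⊓ LinearMap.ker f : Submodule K V) =
      Module.finrank K p := by
  rw [← LinearMap.finrank_range_add_finrank_ker (f.domRestrict p), LinearMap.range_domRestrict,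
    LinearMap.ker_domRestrict, ← Submodule.map_comap_subtype, Submodule.finrank_map_subtype_eq]

theorem finrank_map_mulLeft {G : MvPolynomial (Fin n) K} (hG : G ≠ 0) (m : ℕ) :
    Module.finrank K ((homogeneousSubmodule (Fin n) K m).map (LinearMap.mulLeft K G)) =
      Module.finrank K (homogeneousSubmodule (Fin n) K m) :=
  (Submodule.equivMapOfInjective _ (mul_right_injective₀ hG) _).finrank_eq.symm

variable {F q : MvPolynomial (Fin n) K}

/-- The shift by 5 = 3 + 2 keeps every degree in the count, including that of the multiples of Fq,
nonnegative. -/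
theorem homogeneousSubmodule_inf_span_pair (hF : F.IsHomogeneous 3) (hq : q.IsHomogeneous 2)
    (k : ℕ) :
    homogeneousSubmodule (Fin n) K (k + 5) ⊓
        LinearMap.ker (Ideal.Quotient.mkₐ K (Ideal.span {F, q})).toLinearMap =
      (homogeneousSubmodule (Fin n) K (k + 2)).map (LinearMap.mulLeft K F) ⊔
        (homogeneousSubmodule (Fin n) K (k + 3)).map (LinearMap.mulLeft K q) := by
  have hker : ∀ x, x ∈ LinearMap.ker (Ideal.Quotient.mkₐ K (Ideal.span {F, q})).toLinearMap ↔
      x ∈ Ideal.span {F, q} := fun x => by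
    rw [LinearMap.mem_ker, AlgHom.toLinearMap_apply, Ideal.Quotient.mkₐ_eq_mk,
      Ideal.Quotient.eq_zero_iff_mem]
  ext x
  rw [Submodule.mem_inf, hker, Ideal.mem_span_pair, Submodule.mem_sup]
  constructor
  · rintro ⟨hx, a, b, h⟩
    have h1 := homogeneous_of_eq_mul_add_mul hx hF hq (M := a) (E := b) (by rw [← h]; ring)
    rw [if_pos (by omega), if_pos (by omega)] at h1
    exact ⟨_, ⟨_, homogeneousComponent_isHomogeneous _ a, rfl⟩, _,
      ⟨_, homogeneousComponent_isHomogeneous _ b, rfl⟩, h1.symm⟩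
  · rintro ⟨_, ⟨a, ha, rfl⟩, _, ⟨b, hb, rfl⟩, rfl⟩
    refine ⟨?_, a, b, by simp only [LinearMap.mulLeft_apply]; ring⟩
    have h1 := hF.mul ((mem_homogeneousSubmodule _ _).1 ha)
    have h2 := hq.mul ((mem_homogeneousSubmodule _ _).1 hb)
    rw [show 3 + (k + 2) = k + 5 by ring] at h1
    rw [show 2 + (k + 3) = k + 5 by ring] at h2
    exact h1.add h2

/-- The only syzygies between `F` and `q` are the Koszul ones, because `q` is prime and does not
divide `F`. -/
theorem map_mulLeft_inf_map_mulLeft (hF : F.IsHomogeneous 3) (hq : q.IsHomogeneous 2)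
    (hqp : Prime q) (hqF : ¬ q ∣ F) (k : ℕ) :
    (homogeneousSubmodule (Fin n) K (k + 2)).map (LinearMap.mulLeft K F) ⊓
        (homogeneousSubmodule (Fin n) K (k + 3)).map (LinearMap.mulLeft K q) =
      (homogeneousSubmodule (Fin n) K k).map (LinearMap.mulLeft K (F * q)) := by
  ext x
  rw [Submodule.mem_inf]
  constructor
  · rintro ⟨⟨a, ha, rfl⟩, b, hb, h⟩
    simp only [LinearMap.mulLeft_apply] at h ⊢
    obtain ⟨c, rfl⟩ := (hqp.dvd_or_dvd ⟨b, h.symm⟩).resolve_left hqF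
    have h1 := homogeneous_of_eq_mul_add_mul (M := c) (E := 0) ha hq hq (by ring)
    rw [if_pos (by omega), map_zero, mul_zero, ite_self, add_zero] at h1
    refine ⟨homogeneousComponent k c, homogeneousComponent_isHomogeneous k c, ?_⟩
    rw [LinearMap.mulLeft_apply, h1, mul_assoc]
    rfl
  · rintro ⟨c, hc, rfl⟩
    refine ⟨⟨q * c, ?_, ?_⟩, F * c, ?_, ?_⟩
    · have := hq.mul ((mem_homogeneousSubmodule _ _).1 hc)
      rwa [add_comm] at this
    · simp only [LinearMap.mulLeft_apply]; ring
    · have := hF.mul ((mem_homogeneousSubmodule _ _).1 hc)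
      rwa [add_comm] at this
    · simp only [LinearMap.mulLeft_apply]; ring

theorem hilbertFunction_span_pair (hF : F.IsHomogeneous 3) (hq : q.IsHomogeneous 2)
    (hqp : Prime q) (hqF : ¬ q ∣ F) (k : ℕ) :
    hilbertFunction (Ideal.span {F, q}) (k + 5) + (n + (k + 2) - 1).choose (k + 2) +
        (n + (k + 3) - 1).choose (k + 3) =
      (n + (k + 5) - 1).choose (k + 5) + (n + k - 1).choose k := by
  have hF0 : F ≠ 0 := fun h => hqF (h ▸ dvd_zero q)
  have h1 := Submodule.finrank_map_add_finrank_inf_ker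
    (Ideal.Quotient.mkₐ K (Ideal.span {F, q})).toLinearMap (homogeneousSubmodule (Fin n) K (k + 5))
  have h2 := Submodule.finrank_sup_add_finrank_inf_eq
    ((homogeneousSubmodule (Fin n) K (k + 2)).map (LinearMap.mulLeft K F))
    ((homogeneousSubmodule (Fin n) K (k + 3)).map (LinearMap.mulLeft K q))
  rw [map_mulLeft_inf_map_mulLeft hF hq hqp hqF, finrank_map_mulLeft hF0,
    finrank_map_mulLeft hqp.ne_zero, finrank_map_mulLeft (mul_ne_zero hF0 hqp.ne_zero)] at h2
  rw [homogeneousSubmodule_inf_span_pair hF hq] at h1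
  simp only [finrank_homogeneousSubmodule] at h1 h2
  rw [hilbertFunction]
  omega

/-- Coefficientwise form of (1 - t²)(1 - t³)/(1 - t)^(r+3) = (1 + 2t + 2t² + t³)/(1 - t)^(r+1),
proved by repeated use of Pascal's rule. -/
theorem choose_second_difference (r k : ℕ) :
    (k + 5 + (r + 2)).choose (r + 2) + (k + (r + 2)).choose (r + 2) =
      (k + 3 + (r + 2)).choose (r + 2) + (k + 2 + (r + 2)).choose (r + 2) +
      ((k + 5 + r).choose r + 2 * (k + 4 + r).choose r + 2 * (k + 3 + r).choose r +
        (k + 2 + r).choose r) := by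
  have h : ∀ m s, (m + 1 + (s + 1)).choose (s + 1) =
      (m + 1 + s).choose s + (m + (s + 1)).choose (s + 1) := fun m s => by
    rw [← add_assoc, Nat.choose_succ_succ]
    congr 2
    ring
  have a0 := h k (r + 1)
  have a1 := h (k + 1) (r + 1)
  have a2 := h (k + 2) (r + 1)
  have a3 := h (k + 3) (r + 1)
  have a4 := h (k + 4) (r + 1)
  have b1 := h (k + 1) r
  have b2 := h (k + 2) r
  have b3 := h (k + 3) r
  have b4 := h (k + 4) r
  simp only [add_assoc, Nat.reduceAdd] at *
  omega

theorem hilbertFunction_span_pair_eq {r : ℕ} (hn : n = r + 3) (hF : F.IsHomogeneous 3)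
    (hq : q.IsHomogeneous 2) (hqp : Prime q) (hqF : ¬ q ∣ F) (k : ℕ) :
    hilbertFunction (Ideal.span {F, q}) (k + 5) = (k + 5 + r).choose r +
      2 * (k + 4 + r).choose r + 2 * (k + 3 + r).choose r + (k + 2 + r).choose r := by
  have h1 := hilbertFunction_span_pair hF hq hqp hqF k
  have h2 := choose_second_difference r k
  have h3 : ∀ m, (n + m - 1).choose m = (m + (r + 2)).choose (r + 2) := fun m => by
    rw [hn, show r + 3 + m - 1 = m + (r + 2) by omega, Nat.choose_symm_add]
  rw [h3, h3, h3, h3] at h1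
  omega

theorem coeff_and_natDegree_sum {p : ℕ → Polynomial ℚ} {r : ℕ} {c : ℚ} (hc0 : c ≠ 0)
    (hdeg : ∀ j, (p j).natDegree ≤ r) (hc : ∀ j, (p j).coeff r = c) :
    (p 0 + 2 * p 1 + 2 * p 2 + p 3).coeff r = 6 * c ∧
      (p 0 + 2 * p 1 + 2 * p 2 + p 3).natDegree = r := by
  rw [show p 0 + 2 * p 1 + 2 * p 2 + p 3 = p 0 + p 1 + p 1 + p 2 + p 2 + p 3 by ring]
  have hcoeff : (p 0 + p 1 + p 1 + p 2 + p 2 + p 3).coeff r = 6 * c := by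
    simp only [Polynomial.coeff_add, hc]
    ring
  refine ⟨hcoeff, Polynomial.natDegree_eq_of_le_of_coeff_ne_zero ?_
    (by rw [hcoeff]; exact mul_ne_zero (by norm_num) hc0)⟩
  have hadd : ∀ {a b : Polynomial ℚ}, a.natDegree ≤ r → b.natDegree ≤ r →
      (a + b).natDegree ≤ r := Polynomial.natDegree_add_le_of_degree_le
  exact hadd (hadd (hadd (hadd (hadd (hdeg 0) (hdeg 1)) (hdeg 1)) (hdeg 2)) (hdeg 2)) (hdeg 3)

theorem exists_hilbertPolynomial {r : ℕ} (hn : n = r + 3) (hF : F.IsHomogeneous 3)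
    (hq : q.IsHomogeneous 2) (hqp : Prime q) (hqF : ¬ q ∣ F) :
    ∃ H : Polynomial ℚ,
      (∀ᶠ m : ℕ in Filter.atTop,
        (hilbertFunction (Ideal.span {F, q}) m : ℚ) = H.eval (m : ℚ)) ∧
      (H.natDegree.factorial : ℚ) * H.leadingCoeff = 6 := by
  -- At integers m ≥ j, `p j` takes the value of the binomial coefficient of m - j + r over r. Its
  -- leading coefficient is 1/r! for every j, so the weights 1, 2, 2, 1 add up to 6/r!.
  let p : ℕ → Polynomial ℚ := Polynomial.preHilbertPoly ℚ r
  obtain ⟨hcoeff, hnat⟩ := coeff_and_natDegree_sum (p := p) (r := r)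
    (c := (r.factorial : ℚ)⁻¹) (inv_ne_zero (by positivity))
    (fun j => (Polynomial.natDegree_preHilbertPoly ℚ r j).le)
    (fun j => Polynomial.coeff_preHilbertPoly_self ℚ r j)
  have hr : (r.factorial : ℚ) ≠ 0 := by positivity
  refine ⟨p 0 + 2 * p 1 + 2 * p 2 + p 3, ?_, ?_⟩
  · filter_upwards [Filter.eventually_ge_atTop 5] with m hm
    obtain ⟨k, rfl⟩ := Nat.exists_eq_add_of_le' hm
    have he : ∀ j, j ≤ 3 → (p j).eval ((k + 5 : ℕ) : ℚ) = ((k + 5 - j + r).choose r : ℕ) :=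
      fun j hj => Polynomial.preHilbertPoly_eq_choose_sub_add ℚ r (by omega)
    rw [hilbertFunction_span_pair_eq hn hF hq hqp hqF]
    simp only [Polynomial.eval_add, Polynomial.eval_mul, Polynomial.eval_ofNat, he 0 (by norm_num),
      he 1 (by norm_num), he 2 (by norm_num), he 3 le_rfl]
    push_cast
    rfl
  · rw [Polynomial.leadingCoeff, hnat, hcoeff]
    field_simp

end HilbertFunction

theorem quadFormRank_le {n : ℕ} (Q : MvPolynomial (Fin n) ℚ) : quadFormRank Q ≤ n := by
  simpa [quadFormRank] using (quadFormMatrix Q).rank_le_card_width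

end
theorem lemma3p3 (n : ℕ) (C Q : MvPolynomial (Fin n) ℚ)
    (hC : C.IsHomogeneous 3) (hQ : Q.IsHomogeneous 2)
    (hrank : 5 ≤ quadFormRank Q) (hord : 4 ≤ qOrder Q C) (hh : 2 ≤ hInvariantMod Q C) :
    IsIrreducible (geometricZeroLocus {C, Q}) ∧
      codimension (geometricZeroLocus {C, Q}) = 2 ∧
      HasProjDegree (geometricZeroLocus {C, Q}) 6 := by
  -- Rank at least 5 forces n ≥ 5, so there is a variable to witness that ideals do not contain the
  -- irrelevant one, and r = n - 3 is a genuine subtraction.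
  have hn := hrank.trans (quadFormRank_le Q)
  have hI := isPrime_span_pair hC hQ hrank hord hh
  obtain ⟨hdom, -⟩ := quadric_isDomain_and_ufm (K := AlgebraicClosure ℚ) hQ hrank
  have hqF : ¬ map (algebraMap ℚ (AlgebraicClosure ℚ)) Q ∣
      map (algebraMap ℚ (AlgebraicClosure ℚ)) C := not_map_dvd_of_qOrder hC hQ hord
  have hF := hC.map (algebraMap ℚ (AlgebraicClosure ℚ))
  have hq := hQ.map (algebraMap ℚ (AlgebraicClosure ℚ))
  have hq0 : map (algebraMap ℚ (AlgebraicClosure ℚ)) Q ≠ 0 := by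
    rw [Ne, map_eq_zero_iff _ (map_injective _ (algebraMap ℚ (AlgebraicClosure ℚ)).injective)]
    rintro rfl
    have : quadFormMatrix (0 : MvPolynomial (Fin n) ℚ) = 0 := by
      ext i j; simp [quadFormMatrix]
    simp [quadFormRank, this] at hrank
  have hqp : Prime (map (algebraMap ℚ (AlgebraicClosure ℚ)) Q) :=
    (Ideal.span_singleton_prime hq0).1 ((Ideal.Quotient.isDomain_iff_prime _).1 hdom)
  rw [geometricZeroLocus, Set.image_pair]
  set F' := map (algebraMap ℚ (AlgebraicClosure ℚ)) C
  set q' := map (algebraMap ℚ (AlgebraicClosure ℚ)) Q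
  let i : Fin n := ⟨0, by omega⟩
  have hi := X_notMem_span_pair hF hq i
  have hhom := isHomogeneous_span_pair hF hq
  have hspan := ProjectiveSpectrum.zeroLocus_span
    (homogeneousSubmodule (Fin n) (AlgebraicClosure ℚ)) {F', q'}
  refine ⟨?_, codimension_eq_two hF hq hqp hqF hI i, ?_⟩
  · rw [← hspan]
    exact (projVariety _ hI hhom i hi).isIrreducible
  · obtain ⟨H, hH⟩ := exists_hilbertPolynomial (r := n - 3) (by omega) hF hq hqp hqF
    refine ⟨H, ?_⟩
    -- Primality makes (F, Q) the whole vanishing ideal, so its Hilbert function computes the degree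
    -- of the reduced variety.
    rw [← hspan, vanishingIdeal_zeroLocus_of_isPrime hI hhom hi]
    exact_mod_cast hH
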